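/- **Setting.** For a finite set $U\subset\mathbb R^d$, a finite nonempty $C\subset\mathbb R^d$ and a constant $z\ge 1$ let $\mathrm{cost}_z(U,C)=\sum_{x\in U}\min_{c\in C}\|x-c\|_2^z$, and let $\mathcal C_k$ be the family of point sets $C=\{c_1,\dots,c_k\}$, $c_i\in\mathbb R^d$. A set $V$ is a $(k,A)$-center set for $U$ if $\mathrm{cost}_z(U,V)\le A\cdot\mathrm{cost}_z(U,C)$ for every $C\in\mathcal C_k$. **Algorithm** CenterSetGen, with parameters $\alpha\ge 1$, $\beta\in(0,1)$, $\kappa>0$, accuracy $\varepsilon_0\in(0,0.1)$ and sketch failure parameter $\delta_1\in(0,1)$. Let $s=\lfloor\alpha k\rfloor$ and $m=\lceil\kappa\,(\varepsilon_0/z)^{-2}\log(s/\delta_1)\rceil$. Start with $U_0=U$, $V=\emptyset$, $i=0$. While $|U_i|>\alpha k$: draw $s$ independent uniform samples (with replacement) from $U_i$, forming $S_i$; draw a fresh Gaussian matrix $\Pi_i\in\mathbb R^{m\times d}$ with independent $N(0,1/m)$ entries; let $v_i$ be the smallest $r$ such that at least $\beta|U_i|$ points $x\in U_i$ satisfy $\min_{y\in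 S_i}\|\Pi_i x-\Pi_i y\|_2^z\le r$, and let $C_i$ be the set of all $x\in U_i$ with $\min_{y\in S_i}\|\Pi_i x-\Pi_i y\|_2^z\le v_i$; set $U_{i+1}=U_i\setminus C_i$, $V\leftarrow V\cup S_i$, $i\leftarrow i+1$. After the loop output $V\cup U_i$. **Theorem.** There is an absolute constant $\kappa_0>0$ such that for all constants $z\ge1$, $c_0>1$, $\beta\in(0,1)$, $\rho>0$ there is $\alpha_0\ge1$ such that for every $\alpha\ge\alpha_0$ there is a constant $A\ge 1$ (depending only on $z,c_0,\beta,\rho,\alpha$) with the following property. For every $\kappa\ge\kappa_0$, every $d$, every $k\ge1$, every finite $U\subset\mathbb R^d$ with $n=|U|$ points and $k\ge\rho\log n$, every $\varepsilon_0\in(0,0.1)$ and every $\delta_1\in(0,1)$, the output $V$ of CenterSetGen satisfies, with failure probability at most $e^{-c_0k}+\delta_1$, both 1. $|V|\le A\cdot k\cdot\max\{1,\log(n/k)\}$, and 2. $V$ is a $(k,A)$-center set for $U$, i.e. $\mathrm{cost}_z(U,V)\le A\cdot\mathrm{cost}_z(U,C)$ for every $C\in\mathcal C_k$. -/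

import Mathlib

open MeasureTheory ProbabilityTheory
open scoped ENNReal NNReal Classical

noncomputable section

/-! ### Clustering cost and center sets -/

/-- `d_z(x, C) = min_{c ∈ C} ‖x - c‖₂ ^ z`; used for finite nonempty `C`, where the infimum is a
minimum. -/
def powDist {d : ℕ} (z : ℝ) (x : EuclideanSpace ℝ (Fin d)) (C : Set (EuclideanSpace ℝ (Fin d))) :
    ℝ :=
  ⨅ c : C, ‖x - c.1‖ ^ z

/-- `cost_z(U, C) = ∑_{x ∈ U} d_z(x, C)`. -/
def clusterCost {d : ℕ} (z : ℝ) (U : Finset (EuclideanSpace ℝ (Fin d)))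
    (C : Set (EuclideanSpace ℝ (Fin d))) : ℝ :=
  ∑ x ∈ U, powDist z x C

/-- The domain `𝒞_k` of point sets `C = (c₁, …, c_k)` of size `k` in Euclidean space. -/
def centerFamily (d k : ℕ) : Set (Set (EuclideanSpace ℝ (Fin d))) :=
  {C | ∃ c : Fin k → EuclideanSpace ℝ (Fin d), C = Set.range c}

/-- `V` is a `(k, A)`-center set for `U` (with respect to `cost_z`). The size of `V` is not
restricted. -/
def IsCenterSet {d : ℕ} (z : ℝ) (k : ℕ) (A : ℝ) (U : Finset (EuclideanSpace ℝ (Fin d)))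
    (V : Set (EuclideanSpace ℝ (Fin d))) : Prop :=
  ∀ C ∈ centerFamily d k, clusterCost z U V ≤ A * clusterCost z U C

/-! ### The distance estimation data structure -/

/-- The law of a random Gaussian `m × d` sketching matrix: independent `N(0, 1/m)` entries. -/
def gaussianSketch (m d : ℕ) : Measure (Fin m → Fin d → ℝ) :=
  Measure.pi fun _ => Measure.pi fun _ => gaussianReal 0 (1 / (m : ℝ≥0))

instance (m d : ℕ) : IsProbabilityMeasure (gaussianSketch m d) := by
  unfold gaussianSketch; infer_instance

/-- The sketch `Π x` of a point `x`. -/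
def sketch {m d : ℕ} (P : Fin m → Fin d → ℝ) (x : EuclideanSpace ℝ (Fin d)) :
    EuclideanSpace ℝ (Fin m) :=
  WithLp.toLp 2 (Matrix.mulVec (Matrix.of P) x.ofLp)

/-- The number `m = ⌈κ ε⁻² log (s / δ)⌉` of rows of the sketching matrix that the data structure
chooses for `s` points, failure probability `δ` and accuracy `ε`. -/
def sketchDim (κ : ℝ) (s : ℕ) (δ ε : ℝ) : ℕ :=
  ⌈κ * (ε ^ 2)⁻¹ * Real.log (s / δ)⌉₊

/-- The answer of the data structure to a query `q`: the list of estimates `‖Π q - Π c_j‖₂`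
of the distances of `q` to the stored points `c_j`. -/
def sketchQuery {m d s : ℕ} (P : Fin m → Fin d → ℝ) (c : Fin s → EuclideanSpace ℝ (Fin d))
    (q : EuclideanSpace ℝ (Fin d)) : Fin s → ℝ :=
  fun j => ‖sketch P q - sketch P (c j)‖

/-! ### One round of successive sampling -/

/-- The points of `T` in the union of the balls of radius `r` around the sample `S`, measured by
the `z`-th powers of the estimated distances. -/
def sketchBall {m d s : ℕ} (P : Fin m → Fin d → ℝ) (z : ℝ)
    (T : Finset (EuclideanSpace ℝ (Fin d))) (S : Fin s → EuclideanSpace ℝ (Fin d)) (r : ℝ) :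
    Finset (EuclideanSpace ℝ (Fin d)) :=
  T.filter fun x => ∃ j, sketchQuery P S x j ^ z ≤ r

/-- The smallest radius `v` for which the balls around `S` contain at least `β |T|` points of `T`.
(For `0 < β ≤ 1`, `T` nonempty and `0 < s` the infimum is attained.) -/
def coverRadius {m d s : ℕ} (z β : ℝ) (T : Finset (EuclideanSpace ℝ (Fin d)))
    (S : Fin s → EuclideanSpace ℝ (Fin d)) (P : Fin m → Fin d → ℝ) : ℝ :=
  sInf {r : ℝ | β * (T.card : ℝ) ≤ ((sketchBall P z T S r).card : ℝ)}

/-- The points of `T` that are covered, hence discarded, in a round with current candidates `T`,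
sample `S` and sketching matrix `P`. -/
def coveredSet {m d s : ℕ} (z β : ℝ) (T : Finset (EuclideanSpace ℝ (Fin d)))
    (S : Fin s → EuclideanSpace ℝ (Fin d)) (P : Fin m → Fin d → ℝ) :
    Finset (EuclideanSpace ℝ (Fin d)) :=
  sketchBall P z T S (coverRadius z β T S P)

theorem coveredSet_subset {m d s : ℕ} (z β : ℝ) (T : Finset (EuclideanSpace ℝ (Fin d)))
    (S : Fin s → EuclideanSpace ℝ (Fin d)) (P : Fin m → Fin d → ℝ) :
    coveredSet z β T S P ⊆ T :=
  Finset.filter_subset _ _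

theorem measurable_sketchQuery {m d s : ℕ} (S : Fin s → EuclideanSpace ℝ (Fin d))
    (x : EuclideanSpace ℝ (Fin d)) (j : Fin s) :
    Measurable fun P : Fin m → Fin d → ℝ => sketchQuery P S x j := by
  apply Continuous.measurable
  unfold sketchQuery sketch Matrix.mulVec dotProduct
  simp only [Matrix.of_apply]
  fun_prop

theorem measurableSet_mem_sketchBall {m d s : ℕ} (z : ℝ) (S : Fin s → EuclideanSpace ℝ (Fin d))
    (x : EuclideanSpace ℝ (Fin d)) {f : (Fin m → Fin d → ℝ) → ℝ} (hf : Measurable f) :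
    MeasurableSet {P : Fin m → Fin d → ℝ | ∃ j, sketchQuery P S x j ^ z ≤ f P} := by
  rw [Set.ofPred_exists]
  exact MeasurableSet.iUnion fun j =>
    measurableSet_le ((measurable_sketchQuery S x j).pow_const z) hf

theorem measurable_card_sketchBall {m d s : ℕ} (z : ℝ) (T : Finset (EuclideanSpace ℝ (Fin d)))
    (S : Fin s → EuclideanSpace ℝ (Fin d)) (r : ℝ) :
    Measurable fun P : Fin m → Fin d → ℝ => ((sketchBall P z T S r).card : ℝ) := by
  simp only [sketchBall, Finset.card_filter, Nat.cast_sum, Nat.cast_ite, Nat.cast_one,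
    Nat.cast_zero]
  exact Finset.measurable_fun_sum _ fun x _ => Measurable.ite
    (measurableSet_mem_sketchBall z S x measurable_const) measurable_const measurable_const

theorem sketchBall_mono {m d s : ℕ} (P : Fin m → Fin d → ℝ) (z : ℝ)
    (T : Finset (EuclideanSpace ℝ (Fin d))) (S : Fin s → EuclideanSpace ℝ (Fin d))
    {r r' : ℝ} (h : r ≤ r') : sketchBall P z T S r ⊆ sketchBall P z T S r' := by
  intro x hx
  simp only [sketchBall, Finset.mem_filter] at hx ⊢
  obtain ⟨hT, j, hj⟩ := hx
  exact ⟨hT, j, hj.trans h⟩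

theorem measurable_coverRadius {m d s : ℕ} (z β : ℝ) (T : Finset (EuclideanSpace ℝ (Fin d)))
    (S : Fin s → EuclideanSpace ℝ (Fin d)) :
    Measurable (coverRadius (m := m) z β T S) := by
  by_cases h0 : β * (T.card : ℝ) ≤ 0
  · have : coverRadius (m := m) z β T S = fun _ => 0 := by
      funext P
      have : {r : ℝ | β * (T.card : ℝ) ≤ ((sketchBall P z T S r).card : ℝ)} = Set.univ :=
        Set.eq_univ_of_forall fun r => h0.trans (Nat.cast_nonneg _)
      simp [coverRadius, this]
    rw [this]; exact measurable_const
  push Not at h0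
  have hbdd : ∀ P : Fin m → Fin d → ℝ,
      BddBelow {r : ℝ | β * (T.card : ℝ) ≤ ((sketchBall P z T S r).card : ℝ)} := by
    intro P
    refine ⟨0, fun r hr => ?_⟩
    by_contra! hneg
    have : sketchBall P z T S r = ∅ := by
      refine Finset.filter_eq_empty_iff.2 fun x _ => ?_
      rintro ⟨j, hj⟩
      have : 0 ≤ sketchQuery P S x j ^ z := Real.rpow_nonneg (norm_nonneg _) z
      linarith
    simp only [Set.mem_ofPred_eq, this, Finset.card_empty, Nat.cast_zero] at hr
    linarith
  by_cases hs : Nonempty (Fin s) ∧ β * (T.card : ℝ) ≤ T.card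
  · have hne : ∀ P : Fin m → Fin d → ℝ,
        {r : ℝ | β * (T.card : ℝ) ≤ ((sketchBall P z T S r).card : ℝ)}.Nonempty := by
      intro P
      obtain ⟨j⟩ := hs.1
      refine ⟨∑ x ∈ T, sketchQuery P S x j ^ z, ?_⟩
      have : sketchBall P z T S (∑ x ∈ T, sketchQuery P S x j ^ z) = T := by
        refine Finset.filter_true_of_mem fun x hx => ⟨j, ?_⟩
        exact Finset.single_le_sum (f := fun x => sketchQuery P S x j ^ z)
          (fun y _ => Real.rpow_nonneg (norm_nonneg _) z) hx
      simp only [Set.mem_ofPred_eq, this]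
      exact hs.2
    refine measurable_of_Iio fun a => ?_
    have : coverRadius (m := m) z β T S ⁻¹' Set.Iio a =
        ⋃ q : ℚ, ⋃ _ : (q : ℝ) < a,
          {P | β * (T.card : ℝ) ≤ ((sketchBall P z T S (q : ℝ)).card : ℝ)} := by
      ext P
      simp only [Set.mem_preimage, Set.mem_Iio, coverRadius, csInf_lt_iff (hbdd P) (hne P),
        Set.mem_iUnion, Set.mem_ofPred_eq, exists_prop]
      constructor
      · rintro ⟨r, hr, hra⟩
        obtain ⟨q, hrq, hqa⟩ := exists_rat_btwn hra
        exact ⟨q, hqa, hr.trans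
          (Nat.cast_le.2 (Finset.card_le_card (sketchBall_mono P z T S hrq.le)))⟩
      · rintro ⟨q, hqa, hq⟩
        exact ⟨q, hq, hqa⟩
    rw [this]
    exact MeasurableSet.iUnion fun q => MeasurableSet.iUnion fun _ =>
      measurableSet_le measurable_const (measurable_card_sketchBall z T S q)
  · have : coverRadius (m := m) z β T S = fun _ => 0 := by
      funext P
      have : {r : ℝ | β * (T.card : ℝ) ≤ ((sketchBall P z T S r).card : ℝ)} = ∅ := by
        refine Set.eq_empty_of_forall_notMem fun r hr => hs ⟨?_, ?_⟩
        · by_contra hem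
          have : sketchBall P z T S r = ∅ := by
            refine Finset.filter_eq_empty_iff.2 fun x _ => ?_
            rintro ⟨j, -⟩
            exact hem ⟨j⟩
          simp only [Set.mem_ofPred_eq, this, Finset.card_empty, Nat.cast_zero] at hr
          linarith
        · have hr' : β * (T.card : ℝ) ≤ ((sketchBall P z T S r).card : ℝ) := hr
          refine hr'.trans ?_
          exact_mod_cast Finset.card_le_card (Finset.filter_subset _ _)
      simp [coverRadius, this]
    rw [this]; exact measurable_const

theorem measurableSet_coveredSet_eq {m d s : ℕ} (z β : ℝ)
    (T : Finset (EuclideanSpace ℝ (Fin d))) (S : Fin s → EuclideanSpace ℝ (Fin d))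
    (T' : Finset (EuclideanSpace ℝ (Fin d))) :
    MeasurableSet (coveredSet (m := m) z β T S ⁻¹' {T'}) := by
  by_cases hT : T' ⊆ T
  · have : coveredSet (m := m) z β T S ⁻¹' {T'} =
        ⋂ x ∈ T, {P | (∃ j, sketchQuery P S x j ^ z ≤ coverRadius z β T S P) ↔ x ∈ T'} := by
      ext P
      simp only [Set.mem_preimage, Set.mem_singleton_iff, Set.mem_iInter, Set.mem_ofPred_eq,
        coveredSet, sketchBall, Finset.ext_iff, Finset.mem_filter]
      constructor
      · intro h x hx
        rw [← h x]; simp [hx]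
      · intro h x
        by_cases hx : x ∈ T
        · simp [hx, h x hx]
        · have hx' : x ∉ T' := fun h' => hx (hT h')
          simp [hx, hx']
    rw [this]
    refine Finset.measurableSet_biInter _ fun x _ => ?_
    have hm := measurableSet_mem_sketchBall (m := m) z S x (measurable_coverRadius z β T S)
    by_cases hx : x ∈ T'
    · simpa only [hx, iff_true] using hm
    · simp only [hx, iff_false]
      exact hm.compl
  · have : coveredSet (m := m) z β T S ⁻¹' {T'} = ∅ := by
      refine Set.eq_empty_of_forall_notMem fun P hP => hT ?_
      rw [← Set.mem_singleton_iff.1 hP]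
      exact coveredSet_subset z β T S P
    rw [this]; exact MeasurableSet.empty

/-- The law of the covered set when the sketching matrix is a fresh random Gaussian matrix with
`m` rows. -/
def coveredLaw {d s : ℕ} (m : ℕ) (z β : ℝ) (T : Finset (EuclideanSpace ℝ (Fin d)))
    (S : Fin s → EuclideanSpace ℝ (Fin d)) : PMF (Finset (EuclideanSpace ℝ (Fin d))) :=
  ⟨fun T' => gaussianSketch m d {P | coveredSet z β T S P = T'}, by
    have hsum : ∑ T' ∈ T.powerset, gaussianSketch m d {P | coveredSet z β T S P = T'} = 1 := by
      have := sum_measure_preimage_singleton (μ := gaussianSketch m d) T.powerset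
        (f := coveredSet (m := m) z β T S)
        (fun T' _ => measurableSet_coveredSet_eq z β T S T')
      have huniv : coveredSet (m := m) z β T S ⁻¹' (T.powerset : Set _) = Set.univ := by
        refine Set.eq_univ_of_forall fun P => ?_
        simpa using coveredSet_subset z β T S P
      rw [huniv, measure_univ] at this
      exact this
    rw [← hsum]
    refine hasSum_sum_of_ne_finset_zero fun T' hT' => ?_
    have : {P : Fin m → Fin d → ℝ | coveredSet z β T S P = T'} = ∅ := by
      refine Set.eq_empty_of_forall_notMem fun P hP => hT' ?_
      have hP' : coveredSet z β T S P = T' := hP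
      rw [← hP', Finset.mem_powerset]
      exact coveredSet_subset z β T S P
    rw [this, measure_empty]⟩

/-- `s` independent uniform samples (with replacement) from a nonempty finite set `T`. -/
def sampleLaw {d : ℕ} (s : ℕ) (T : Finset (EuclideanSpace ℝ (Fin d))) (hT : T.Nonempty) :
    PMF (Fin s → EuclideanSpace ℝ (Fin d)) :=
  haveI : Nonempty T := hT.to_subtype
  (PMF.uniformOfFintype (Fin s → T)).map fun f j => (f j : EuclideanSpace ℝ (Fin d))

/-! ### The algorithm -/

/-- The main loop with current candidates `T` and current center set `V`: while `|T| > s`, draw a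
sample `S` of `s` points from `T`, build the data structure on `S` with a fresh sketching matrix
with `m` rows, discard the covered points of `T` and add `S` to `V`; after the loop add the
remaining candidates to `V`. The first argument bounds the number of rounds. -/
def centerSetLoop {d : ℕ} (m s : ℕ) (z β : ℝ) :
    ℕ → Finset (EuclideanSpace ℝ (Fin d)) → Finset (EuclideanSpace ℝ (Fin d)) →
      PMF (Finset (EuclideanSpace ℝ (Fin d)))
  | 0, T, V => PMF.pure (V ∪ T)
  | N + 1, T, V =>
    if h : s < T.card then
      (sampleLaw s T (Finset.card_pos.1 (Nat.zero_lt_of_lt h))).bind fun S =>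
        (coveredLaw m z β T S).bind fun C =>
          centerSetLoop m s z β N (T \ C) (V ∪ Finset.univ.image S)
    else PMF.pure (V ∪ T)

/-- The law of the output `V` of `CenterSetGen` on input `U`, with `⌊α k⌋` samples per round,
covering fraction `β`, constant `κ` in the sketch dimension, accuracy `ε₀ / z` and failure
probability `δ` for the data structure. The loop condition `|T| > α k` is `|T| > ⌊α k⌋`, as `|T|`
is a natural number. For `β > 0` every round discards at least one point, so that `|U|` rounds
always suffice and the bound on the number of rounds has no effect. -/
def centerSetGen {d : ℕ} (α β κ z ε₀ δ : ℝ) (k : ℕ) (U : Finset (EuclideanSpace ℝ (Fin d))) :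
    PMF (Finset (EuclideanSpace ℝ (Fin d))) :=
  centerSetLoop (sketchDim κ ⌊α * k⌋₊ δ (ε₀ / z)) ⌊α * k⌋₊ z β U.card U ∅

end

/-! Put `g = (1 - β) / 3`. In a round with candidates `T`, let `r` be the least radius at which `k`
balls centred in `T` hold a `β + 2g` fraction of `T`. Except with probability `e^(k - g s)`, the
balls missed by the sample hold less than a `g` fraction, so a `β + g` fraction lies within `2r` of
the sample (`sampleLaw_hit`). By minimality of `r`, any `k` centres leave a `g` fraction of `T` at
distance at least `r / 2` (`exists_optimal_balls`).

The sketch has too few rows for a union bound over `T`, but Markov's inequality suffices. Few points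
have their distance to a nearby sample more than doubled, so a `β` fraction is covered at sketched
distance `4r`; distances that shrink too much matter only on average, through `shrinkExcess`, whose
mean is tiny. Hence the discarded points cost `O(|T| μ)` with `μ = (r / 2) ^ z` (`round_isCheap`).

Charging each round separately to the far points would charge the same points many times. The
invariant `IsGoodOutput` therefore carries a threshold `M`, paid at a flat rate by every remaining
candidate, plus the part of the cost of `C` above `M`. If `μ > M`, the threshold is raised to `μ`,
and the drop of the truncated cost on the far points pays for the raise; the flat part pays for the
round because `|T|` shrinks by the factor `1 - β` (`IsGoodOutput.step`). Starting at `M = 0` gives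
the center-set bound.

There are at most `1 + log(n / s) / β` rounds, which is `O(k)` since `k ≥ ρ log n`. For large `α`
the sampling failures thus sum to at most `e^(-c₀ k)`, and sketch failures of `δ / s` per round to
at most `δ`. -/

noncomputable section

/-! ### Gaussian sketches: moment generating function and tails -/

theorem map_pi_gaussianReal_dotProduct {d : ℕ} (v : ℝ≥0) (w : EuclideanSpace ℝ (Fin d)) :
    (Measure.pi fun _ : Fin d => gaussianReal 0 v).map (fun a => ∑ j, a j * w j) =
      gaussianReal 0 (v * ‖w‖₊ ^ 2) := by
  have hmeas : Measurable fun a : Fin d → ℝ => ∑ j, a j * w j := by fun_prop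
  have := Measure.isProbabilityMeasure_map
    (μ := Measure.pi fun _ : Fin d => gaussianReal 0 v) hmeas.aemeasurable
  -- By independence the characteristic function factors over the coordinates, and the variances `v
  -- * w j ^ 2` add up to `v * ‖w‖ ^ 2`.
  refine Measure.ext_of_charFun (funext fun t => ?_)
  rw [charFun_apply_real, integral_map hmeas.aemeasurable (by fun_prop)]
  have h1 : ∀ a : Fin d → ℝ, Complex.exp (t * ((∑ j, a j * w j : ℝ) : ℂ) * Complex.I) =
      ∏ j, Complex.exp (((t * w j : ℝ) : ℂ) * (a j : ℂ) * Complex.I) := by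
    intro a
    rw [← Complex.exp_sum]
    congr 1
    push_cast
    rw [Finset.mul_sum, Finset.sum_mul]
    exact Finset.sum_congr rfl fun j _ => by ring
  simp_rw [h1]
  rw [integral_fintype_prod_eq_prod
    (f := fun j (x : ℝ) => Complex.exp (((t * w j : ℝ) : ℂ) * (x : ℂ) * Complex.I))]
  simp_rw [← charFun_apply_real, charFun_gaussianReal]
  rw [← Complex.exp_sum]
  congr 1
  have h2 : ‖w‖ ^ 2 = ∑ j, w j ^ 2 := by
    rw [EuclideanSpace.norm_sq_eq]; simp
  have h3 : ((‖w‖ : ℝ) : ℂ) ^ 2 = ∑ j, ((w j : ℝ) : ℂ) ^ 2 := by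
    rw [← Complex.ofReal_pow, h2]; push_cast; rfl
  simp only [NNReal.coe_mul, NNReal.coe_pow, coe_nnnorm, Complex.ofReal_mul, Complex.ofReal_pow, h3]
  rw [Finset.mul_sum, Finset.sum_mul, Finset.sum_div]
  simp only [Complex.ofReal_zero, mul_zero, zero_mul, zero_sub, Finset.sum_neg_distrib]
  congr 1
  exact Finset.sum_congr rfl fun j _ => by ring

theorem integral_exp_mul_sq_gaussianReal {v : ℝ≥0} (hv : v ≠ 0) {t : ℝ} (ht : 2 * v * t < 1) :
    ∫ x, Real.exp (t * x ^ 2) ∂gaussianReal 0 v = (√(1 - 2 * v * t))⁻¹ := by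
  have hv' : (0 : ℝ) < v := by exact_mod_cast pos_iff_ne_zero.2 hv
  rw [integral_gaussianReal_eq_integral_smul hv]
  have h : ∀ x : ℝ, gaussianPDFReal 0 v x • Real.exp (t * x ^ 2) =
      (√(2 * Real.pi * v))⁻¹ * Real.exp (-((1 - 2 * v * t) / (2 * v)) * x ^ 2) := by
    intro x
    rw [gaussianPDFReal, smul_eq_mul, mul_assoc, ← Real.exp_add]
    congr 2
    field_simp
    ring
  simp_rw [h]
  rw [integral_const_mul, integral_gaussian, ← Real.sqrt_inv, ← Real.sqrt_inv,
    ← Real.sqrt_mul (by positivity)]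
  congr 1
  have : 1 - 2 * v * t ≠ 0 := by linarith
  field_simp

theorem norm_sketch_sq {m d : ℕ} (P : Fin m → Fin d → ℝ) (w : EuclideanSpace ℝ (Fin d)) :
    ‖sketch P w‖ ^ 2 = ∑ i, (∑ j, P i j * w j) ^ 2 := by
  rw [EuclideanSpace.norm_sq_eq]
  simp [sketch, Matrix.mulVec, dotProduct]

theorem sketch_sub {m d : ℕ} (P : Fin m → Fin d → ℝ) (x y : EuclideanSpace ℝ (Fin d)) :
    sketch P (x - y) = sketch P x - sketch P y := by
  simp [sketch, Matrix.mulVec_sub]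

theorem measurable_norm_sketch {m d : ℕ} (w : EuclideanSpace ℝ (Fin d)) :
    Measurable fun P : Fin m → Fin d → ℝ => ‖sketch P w‖ := by
  apply Continuous.measurable
  unfold sketch Matrix.mulVec dotProduct
  simp only [Matrix.of_apply]
  fun_prop

/-- The moment generating function of a rescaled `χ²` variable with `m` degrees of freedom. -/
theorem integral_exp_norm_sketch_sq {m d : ℕ} (hm : 0 < m) {w : EuclideanSpace ℝ (Fin d)}
    (hw : w ≠ 0) {τ : ℝ} (hτ : 2 * τ < 1) :
    ∫ P, Real.exp (τ * m / ‖w‖ ^ 2 * ‖sketch P w‖ ^ 2) ∂gaussianSketch m d =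
      (√(1 - 2 * τ))⁻¹ ^ m := by
  have hw' : 0 < ‖w‖ := norm_pos_iff.2 hw
  have hm' : (0 : ℝ) < m := by exact_mod_cast hm
  have h1 : ∀ P : Fin m → Fin d → ℝ, Real.exp (τ * m / ‖w‖ ^ 2 * ‖sketch P w‖ ^ 2) =
      ∏ i, Real.exp (τ * m / ‖w‖ ^ 2 * (∑ j, P i j * w j) ^ 2) := by
    intro P
    rw [norm_sketch_sq, Finset.mul_sum, Real.exp_sum]
  simp_rw [h1]
  rw [gaussianSketch, integral_fintype_prod_eq_prod
    (f := fun _ (a : Fin d → ℝ) => Real.exp (τ * m / ‖w‖ ^ 2 * (∑ j, a j * w j) ^ 2))]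
  have h2 : ∫ a : Fin d → ℝ, Real.exp (τ * m / ‖w‖ ^ 2 * (∑ j, a j * w j) ^ 2)
      ∂(Measure.pi fun _ => gaussianReal 0 (1 / (m : ℝ≥0))) = (√(1 - 2 * τ))⁻¹ := by
    have h3 := integral_map (μ := Measure.pi fun _ : Fin d => gaussianReal 0 (1 / (m : ℝ≥0)))
      (φ := fun a => ∑ j, a j * w j) (f := fun x => Real.exp (τ * m / ‖w‖ ^ 2 * x ^ 2))
      (Measurable.aemeasurable (by fun_prop)) (by fun_prop)
    rw [← h3, map_pi_gaussianReal_dotProduct, integral_exp_mul_sq_gaussianReal]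
    · congr 2
      push_cast
      field_simp
    · have : (‖w‖₊ : ℝ≥0) ≠ 0 := by simpa using hw
      positivity
    · push_cast
      convert hτ using 1
      field_simp
  rw [h2, Finset.prod_const, Finset.card_univ, Fintype.card_fin]

/-- The Bochner integral of a non-integrable function is `0`, whereas the computed value is
positive. -/
theorem integrable_exp_norm_sketch_sq {m d : ℕ} (hm : 0 < m) {w : EuclideanSpace ℝ (Fin d)}
    (hw : w ≠ 0) {τ : ℝ} (hτ : 2 * τ < 1) :
    Integrable (fun P => Real.exp (τ * m / ‖w‖ ^ 2 * ‖sketch P w‖ ^ 2)) (gaussianSketch m d) := by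
  by_contra h
  have h1 := integral_exp_norm_sketch_sq hm hw hτ
  rw [integral_undef h] at h1
  have : 0 < √(1 - 2 * τ) := Real.sqrt_pos.2 (by linarith)
  have : 0 < (√(1 - 2 * τ))⁻¹ ^ m := by positivity
  linarith

/-- Chernoff's bound with `τ = 1 / 4`: each row contributes a factor `e⁻¹ √2 ≤ e^(-1/2)`, because `2
≤ e`. -/
theorem gaussianSketch_two_mul_lt_norm_sketch_le {m d : ℕ} (hm : 0 < m)
    (w : EuclideanSpace ℝ (Fin d)) :
    gaussianSketch m d {P | 2 * ‖w‖ < ‖sketch P w‖} ≤ ENNReal.ofReal (Real.exp (-(m / 2 : ℝ))) := by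
  by_cases hw : w = 0
  · simp [hw, sketch]
  have hw' : 0 < ‖w‖ := norm_pos_iff.2 hw
  have hm' : (0 : ℝ) < m := by exact_mod_cast hm
  have h1 := measure_ge_le_exp_mul_mgf (μ := gaussianSketch m d)
    (X := fun P => ‖sketch P w‖ ^ 2) (4 * ‖w‖ ^ 2) (t := 1 / 4 * m / ‖w‖ ^ 2) (by positivity)
    (integrable_exp_norm_sketch_sq hm hw (by norm_num))
  rw [mgf, integral_exp_norm_sketch_sq hm hw (by norm_num)] at h1
  have h2 : Real.exp (-(1 / 4 * m / ‖w‖ ^ 2) * (4 * ‖w‖ ^ 2)) * (√(1 - 2 * (1 / 4)))⁻¹ ^ m ≤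
      Real.exp (-(m / 2 : ℝ)) := by
    have h3 : -(1 / 4 * m / ‖w‖ ^ 2) * (4 * ‖w‖ ^ 2) = m * (-1 : ℝ) := by field_simp
    have h4 : (√(1 - 2 * (1 / 4)))⁻¹ ≤ Real.exp (1 / 2) := by
      rw [← Real.sqrt_inv, Real.sqrt_le_left (Real.exp_pos _).le, ← Real.exp_nat_mul]
      norm_num
      linarith [Real.add_one_le_exp (1 : ℝ)]
    have h5 : -(m / 2 : ℝ) = m * (-1 / 2) := by ring
    rw [h3, h5, Real.exp_nat_mul, Real.exp_nat_mul, ← mul_pow]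
    gcongr
    calc Real.exp (-1) * (√(1 - 2 * (1 / 4)))⁻¹ ≤ Real.exp (-1) * Real.exp (1 / 2) := by gcongr
      _ = _ := by rw [← Real.exp_add]; norm_num
  rw [← ENNReal.ofReal_toReal (measure_ne_top (gaussianSketch m d) _)]
  refine ENNReal.ofReal_le_ofReal (le_trans (measureReal_mono (fun P hP => ?_)) (h1.trans h2))
  have hP' : 2 * ‖w‖ < ‖sketch P w‖ := hP
  show 4 * ‖w‖ ^ 2 ≤ ‖sketch P w‖ ^ 2
  nlinarith

/-- Chernoff's bound with `τ = -1 / (2 η²)`: each row contributes `e^(1/2) (1 + 1 / η²)^(-1/2) ≤ 2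
η`. -/
theorem gaussianSketch_norm_sketch_le_mul_le {m d : ℕ} (hm : 0 < m)
    {w : EuclideanSpace ℝ (Fin d)} (hw : w ≠ 0) {η : ℝ} (hη : 0 < η) :
    gaussianSketch m d {P | ‖sketch P w‖ ≤ η * ‖w‖} ≤ ENNReal.ofReal ((2 * η) ^ m) := by
  have hw' : 0 < ‖w‖ := norm_pos_iff.2 hw
  have hm' : (0 : ℝ) < m := by exact_mod_cast hm
  have hτ : 2 * (-(1 / (2 * η ^ 2))) < 1 := by
    have : 0 < 1 / (2 * η ^ 2) := by positivity
    linarith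
  have h1 := measure_le_le_exp_mul_mgf (μ := gaussianSketch m d)
    (X := fun P => ‖sketch P w‖ ^ 2) (η ^ 2 * ‖w‖ ^ 2) (t := -(1 / (2 * η ^ 2)) * m / ‖w‖ ^ 2)
    (by
      have : 0 ≤ 1 / (2 * η ^ 2) * m / ‖w‖ ^ 2 := by positivity
      rw [neg_mul, neg_div]; linarith)
    (integrable_exp_norm_sketch_sq hm hw hτ)
  rw [mgf, integral_exp_norm_sketch_sq hm hw hτ] at h1
  have h2 : Real.exp (-(-(1 / (2 * η ^ 2)) * m / ‖w‖ ^ 2) * (η ^ 2 * ‖w‖ ^ 2)) *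
      (√(1 - 2 * (-(1 / (2 * η ^ 2)))))⁻¹ ^ m ≤ (2 * η) ^ m := by
    have h3 : -(-(1 / (2 * η ^ 2)) * m / ‖w‖ ^ 2) * (η ^ 2 * ‖w‖ ^ 2) = m * (1 / 2 : ℝ) := by
      field_simp
    have h4 : (√(1 - 2 * (-(1 / (2 * η ^ 2)))))⁻¹ ≤ η := by
      rw [← Real.sqrt_inv, Real.sqrt_le_left hη.le]
      rw [inv_le_comm₀ (by linarith) (by positivity)]
      have : (η ^ 2)⁻¹ = 2 * (1 / (2 * η ^ 2)) := by field_simp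
      linarith
    have h5 : Real.exp (1 / 2) ≤ 2 := by
      have h6 : Real.exp (1 / 2) ^ 2 ≤ 2 ^ 2 := by
        rw [← Real.exp_nat_mul]; norm_num
        linarith [Real.exp_one_lt_d9]
      exact le_of_sq_le_sq h6 (by norm_num)
    rw [h3, Real.exp_nat_mul, ← mul_pow]
    gcongr
  rw [← ENNReal.ofReal_toReal (measure_ne_top (gaussianSketch m d) _)]
  refine ENNReal.ofReal_le_ofReal (le_trans (measureReal_mono (fun P hP => ?_)) (h1.trans h2))
  have hP' : ‖sketch P w‖ ≤ η * ‖w‖ := hP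
  show ‖sketch P w‖ ^ 2 ≤ η ^ 2 * ‖w‖ ^ 2
  rw [← mul_pow]
  gcongr

/-! ### Excess of a sketch that shrinks distances -/

/-- A dyadic majorant of `(‖w‖ / ‖Π w‖) ^ z` on the event that the sketch shrinks `w` by a factor
of at least `16`. -/
def shrinkExcess {m d : ℕ} (z : ℝ) (w : EuclideanSpace ℝ (Fin d)) (P : Fin m → Fin d → ℝ) :
    ℝ≥0∞ :=
  ∑' l : ℕ, {P : Fin m → Fin d → ℝ | w ≠ 0 ∧ ‖sketch P w‖ ≤ (1 / 2) ^ (l + 4) * ‖w‖}.indicator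
    (fun _ => ENNReal.ofReal ((2 ^ (l + 5)) ^ z)) P

theorem measurableSet_norm_sketch_le {m d : ℕ} (w : EuclideanSpace ℝ (Fin d)) (η : ℝ) :
    MeasurableSet {P : Fin m → Fin d → ℝ | w ≠ 0 ∧ ‖sketch P w‖ ≤ η} :=
  (MeasurableSet.const _).inter (measurableSet_le (measurable_norm_sketch w) measurable_const)

theorem measurable_shrinkExcess {m d : ℕ} (z : ℝ) (w : EuclideanSpace ℝ (Fin d)) :
    Measurable (shrinkExcess (m := m) z w) := by
  unfold shrinkExcess
  exact Measurable.tsum fun l =>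
    measurable_const.indicator (measurableSet_norm_sketch_le w _)

/-- The weight `2^((l+5) z)` at scale `l` is beaten by the probability `2^(-(l+3) m)` of such a
shrinkage: as `z ≤ m / 3` and `m ≥ 3`, the product is at most `2^(-m-l)`, a geometric series. -/
theorem lintegral_shrinkExcess_le {m d : ℕ} {z : ℝ} (hz : 1 ≤ z) (hm : 3 * z ≤ m)
    (w : EuclideanSpace ℝ (Fin d)) :
    ∫⁻ P, shrinkExcess z w P ∂gaussianSketch m d ≤ ENNReal.ofReal (2 * (1 / 2) ^ m) := by
  have hm1 : (3 : ℝ) ≤ m := by linarith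
  have hm0 : 0 < m := by
    have : (0 : ℝ) < m := by linarith
    exact_mod_cast this
  unfold shrinkExcess
  rw [lintegral_tsum fun l => (measurable_const.indicator
    (measurableSet_norm_sketch_le w _)).aemeasurable]
  have hterm : ∀ l : ℕ, ∫⁻ P, {P : Fin m → Fin d → ℝ | w ≠ 0 ∧
      ‖sketch P w‖ ≤ (1 / 2) ^ (l + 4) * ‖w‖}.indicator
        (fun _ => ENNReal.ofReal ((2 ^ (l + 5)) ^ z)) P ∂gaussianSketch m d ≤
      ENNReal.ofReal ((1 / 2) ^ m * (1 / 2) ^ l) := by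
    intro l
    rw [lintegral_indicator_const (measurableSet_norm_sketch_le w _)]
    by_cases hw : w = 0
    · simp [hw]
    simp only [ne_eq, hw, not_false_eq_true, true_and]
    calc _ ≤ ENNReal.ofReal ((2 ^ (l + 5)) ^ z) *
          ENNReal.ofReal ((2 * (1 / 2) ^ (l + 4)) ^ m) := by
          gcongr
          exact gaussianSketch_norm_sketch_le_mul_le hm0 hw (by positivity)
      _ ≤ _ := by
          rw [← ENNReal.ofReal_mul (by positivity)]
          apply ENNReal.ofReal_le_ofReal
          have e1 : ((2 : ℝ) ^ (l + 5)) ^ z = 2 ^ ((l + 5) * z) := by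
            rw [← Real.rpow_natCast, ← Real.rpow_mul (by norm_num)]
            push_cast; rfl
          have e2 : ((2 : ℝ) * (1 / 2) ^ (l + 4)) ^ m = 2 ^ (-((l + 3) * m : ℝ)) := by
            have : (2 : ℝ) * (1 / 2) ^ (l + 4) = 2 ^ (-(l + 3 : ℝ)) := by
              rw [Real.rpow_neg (by norm_num)]
              have : (l + 3 : ℝ) = ((l + 3 : ℕ) : ℝ) := by push_cast; rfl
              rw [this, Real.rpow_natCast, one_div, inv_pow, pow_succ _ (l + 3)]
              field_simp
            rw [this, ← Real.rpow_natCast, ← Real.rpow_mul (by norm_num)]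
            ring_nf
          have e3 : ∀ n : ℕ, ((1 : ℝ) / 2) ^ n = 2 ^ (-(n : ℝ)) := by
            intro n
            rw [Real.rpow_neg (by norm_num), Real.rpow_natCast, one_div, inv_pow]
          rw [e1, e2, e3, e3, ← Real.rpow_add (by norm_num), ← Real.rpow_add (by norm_num)]
          apply Real.rpow_le_rpow_of_exponent_le (by norm_num)
          have hl : (0 : ℝ) ≤ l := Nat.cast_nonneg l
          nlinarith [mul_le_mul_of_nonneg_left hm (by linarith : (0 : ℝ) ≤ l + 5),
            mul_nonneg hl (sub_nonneg.2 hm1)]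
  refine (ENNReal.tsum_le_tsum hterm).trans ?_
  rw [← ENNReal.ofReal_tsum_of_nonneg (fun l => by positivity)
    (summable_geometric_two.mul_left _), tsum_mul_left, tsum_geometric_two]
  exact le_of_eq (by ring_nf)

/-- Up to the excess, a sketch preserves distances from below. -/
theorem norm_rpow_le_of_shrinkExcess_ne_top {m d : ℕ} {z : ℝ} (hz : 1 ≤ z)
    {w : EuclideanSpace ℝ (Fin d)} {P : Fin m → Fin d → ℝ} (h : shrinkExcess z w P ≠ ∞) :
    ‖w‖ ^ z ≤ (16 ^ z + (shrinkExcess z w P).toReal) * ‖sketch P w‖ ^ z := by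
  have hz0 : 0 ≤ z := by linarith
  by_cases hw : w = 0
  · subst hw
    rw [norm_zero, Real.zero_rpow (by linarith)]
    have : 0 ≤ (shrinkExcess z 0 P).toReal := ENNReal.toReal_nonneg
    positivity
  have hw' : 0 < ‖w‖ := norm_pos_iff.2 hw
  have hterm : ∀ l : ℕ, ‖sketch P w‖ ≤ (1 / 2) ^ (l + 4) * ‖w‖ →
      ENNReal.ofReal ((2 ^ (l + 5)) ^ z) ≤ shrinkExcess z w P := by
    intro l hl
    refine le_trans (le_of_eq ?_) (ENNReal.le_tsum l)
    rw [Set.indicator_of_mem]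
    exact ⟨hw, hl⟩
  -- If `Π w = 0`, every indicator in the series is switched on and the unbounded weights make the
  -- excess infinite.
  have hpos : 0 < ‖sketch P w‖ := by
    by_contra h0
    have h0' : ‖sketch P w‖ = 0 := le_antisymm (not_lt.1 h0) (norm_nonneg _)
    obtain ⟨n, hn⟩ := exists_nat_gt (shrinkExcess z w P).toReal
    have h1 := hterm n (by rw [h0']; positivity)
    rw [ENNReal.ofReal_le_iff_le_toReal h] at h1
    have h2 : (n : ℝ) ≤ (2 ^ (n + 5)) ^ z := by
      calc (n : ℝ) ≤ 2 ^ (n + 5) := by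
            have : n < 2 ^ (n + 5) := (Nat.lt_two_pow_self (n := n)).trans
              (Nat.pow_lt_pow_right (by norm_num) (by omega))
            exact_mod_cast this.le
        _ ≤ _ := Real.self_le_rpow_of_one_le (one_le_pow₀ (by norm_num)) hz
    linarith
  have key : ∀ c : ℝ, 0 ≤ c → ‖w‖ ≤ c * ‖sketch P w‖ →
      c ^ z ≤ 16 ^ z + (shrinkExcess z w P).toReal →
      ‖w‖ ^ z ≤ (16 ^ z + (shrinkExcess z w P).toReal) * ‖sketch P w‖ ^ z := by
    intro c hc h1 h2
    calc ‖w‖ ^ z ≤ (c * ‖sketch P w‖) ^ z := by gcongr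
      _ = c ^ z * ‖sketch P w‖ ^ z := Real.mul_rpow hc hpos.le
      _ ≤ _ := by gcongr
  by_cases h16 : ‖w‖ ≤ 16 * ‖sketch P w‖
  · exact key 16 (by norm_num) h16 (le_add_of_nonneg_right ENNReal.toReal_nonneg)
  -- For the first such `l`, the indicator at `l` is on by minimality (by the failure of `h16` when
  -- `l = 0`), and its weight matches `‖w‖ ≤ 2^(l+5) ‖Π w‖`.
  have hex : ∃ l : ℕ, (1 / 2 : ℝ) ^ (l + 5) * ‖w‖ < ‖sketch P w‖ := by
    obtain ⟨n, hn⟩ := exists_pow_lt_of_lt_one (div_pos hpos hw') (by norm_num : (1 / 2 : ℝ) < 1)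
    refine ⟨n, (lt_div_iff₀ hw').1 (lt_of_le_of_lt ?_ hn)⟩
    exact pow_le_pow_of_le_one (by norm_num) (by norm_num) (by omega)
  have hl := Nat.find_spec hex
  set l := Nat.find hex with hldef
  have hl' : ‖sketch P w‖ ≤ (1 / 2) ^ (l + 4) * ‖w‖ := by
    rcases Nat.eq_zero_or_pos l with h0 | h0
    · rw [h0]; norm_num; linarith
    · have h1 := Nat.find_min hex (m := l - 1) (by omega)
      rw [show l - 1 + 5 = l + 4 by omega] at h1
      exact not_lt.1 h1
  have h1 := hterm l hl'
  rw [ENNReal.ofReal_le_iff_le_toReal h] at h1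
  refine key (2 ^ (l + 5)) (by positivity) ?_ (h1.trans (le_add_of_nonneg_left (by positivity)))
  rw [one_div, inv_pow, inv_mul_lt_iff₀ (by positivity)] at hl
  exact hl.le

/-! ### Clustering cost and the covering radius -/

theorem powDist_nonneg {d : ℕ} (z : ℝ) (x : EuclideanSpace ℝ (Fin d))
    (C : Set (EuclideanSpace ℝ (Fin d))) : 0 ≤ powDist z x C :=
  Real.iInf_nonneg fun _ => Real.rpow_nonneg (norm_nonneg _) z

theorem powDist_le {d : ℕ} (z : ℝ) (x : EuclideanSpace ℝ (Fin d))
    {C : Set (EuclideanSpace ℝ (Fin d))} {c : EuclideanSpace ℝ (Fin d)} (hc : c ∈ C) :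
    powDist z x C ≤ ‖x - c‖ ^ z :=
  ciInf_le (f := fun c : C => ‖x - c.1‖ ^ z)
    ⟨0, by rintro _ ⟨c, rfl⟩; exact Real.rpow_nonneg (norm_nonneg _) z⟩ ⟨c, hc⟩

theorem powDist_anti {d : ℕ} (z : ℝ) (x : EuclideanSpace ℝ (Fin d))
    {C D : Set (EuclideanSpace ℝ (Fin d))} (hC : C.Nonempty) (h : C ⊆ D) :
    powDist z x D ≤ powDist z x C := by
  have := hC.to_subtype
  exact le_ciInf fun c => powDist_le z x (h c.2)

theorem clusterCost_anti {d : ℕ} (z : ℝ) (U : Finset (EuclideanSpace ℝ (Fin d)))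
    {C D : Set (EuclideanSpace ℝ (Fin d))} (hC : C.Nonempty) (h : C ⊆ D) :
    clusterCost z U D ≤ clusterCost z U C :=
  Finset.sum_le_sum fun x _ => powDist_anti z x hC h

theorem clusterCost_eq_zero_of_subset {d : ℕ} {z : ℝ} (hz : 1 ≤ z)
    {U : Finset (EuclideanSpace ℝ (Fin d))} {C : Set (EuclideanSpace ℝ (Fin d))}
    (h : (U : Set (EuclideanSpace ℝ (Fin d))) ⊆ C) : clusterCost z U C = 0 := by
  refine Finset.sum_eq_zero fun x hx => le_antisymm ?_ (powDist_nonneg z x C)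
  refine (powDist_le z x (h hx)).trans_eq ?_
  rw [sub_self, norm_zero, Real.zero_rpow (by linarith)]

theorem sketchQuery_eq {m d s : ℕ} (P : Fin m → Fin d → ℝ)
    (S : Fin s → EuclideanSpace ℝ (Fin d)) (x : EuclideanSpace ℝ (Fin d)) (j : Fin s) :
    sketchQuery P S x j = ‖sketch P (x - S j)‖ := by
  rw [sketchQuery, sketch_sub]

theorem sketchBall_eq_empty {m d s : ℕ} (P : Fin m → Fin d → ℝ) (z : ℝ)
    (T : Finset (EuclideanSpace ℝ (Fin d))) (S : Fin s → EuclideanSpace ℝ (Fin d)) {r : ℝ}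
    (hr : r < 0) : sketchBall P z T S r = ∅ := by
  refine Finset.filter_eq_empty_iff.2 fun x _ => ?_
  rintro ⟨j, hj⟩
  have : 0 ≤ sketchQuery P S x j ^ z := Real.rpow_nonneg (norm_nonneg _) z
  linarith

theorem nonneg_of_le_card_sketchBall {m d s : ℕ} {P : Fin m → Fin d → ℝ} {z a : ℝ}
    {T : Finset (EuclideanSpace ℝ (Fin d))} {S : Fin s → EuclideanSpace ℝ (Fin d)} {r : ℝ}
    (ha : 0 < a) (h : a ≤ ((sketchBall P z T S r).card : ℝ)) : 0 ≤ r := by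
  by_contra! hr
  rw [sketchBall_eq_empty P z T S hr] at h
  simp at h
  linarith

theorem coverRadius_le {m d s : ℕ} {P : Fin m → Fin d → ℝ} {z β : ℝ}
    {T : Finset (EuclideanSpace ℝ (Fin d))} {S : Fin s → EuclideanSpace ℝ (Fin d)} {r : ℝ}
    (hβ : 0 < β * (T.card : ℝ)) (h : β * (T.card : ℝ) ≤ ((sketchBall P z T S r).card : ℝ)) :
    coverRadius z β T S P ≤ r :=
  csInf_le ⟨0, fun _ hr => nonneg_of_le_card_sketchBall hβ hr⟩ h

theorem exists_le_card_sketchBall {m d s : ℕ} (P : Fin m → Fin d → ℝ) (z : ℝ) {β : ℝ}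
    (hβ : β ≤ 1) (T : Finset (EuclideanSpace ℝ (Fin d))) (S : Fin s → EuclideanSpace ℝ (Fin d))
    (j : Fin s) : ∃ r, β * (T.card : ℝ) ≤ ((sketchBall P z T S r).card : ℝ) := by
  refine ⟨∑ x ∈ T, sketchQuery P S x j ^ z, ?_⟩
  have : sketchBall P z T S (∑ x ∈ T, sketchQuery P S x j ^ z) = T :=
    Finset.filter_true_of_mem fun x hx => ⟨j, Finset.single_le_sum
      (f := fun x => sketchQuery P S x j ^ z)
      (fun y _ => Real.rpow_nonneg (norm_nonneg _) z) hx⟩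
  rw [this]
  exact mul_le_of_le_one_left (Nat.cast_nonneg _) hβ

/-- The infimum defining the covering radius is attained. -/
theorem le_card_coveredSet {m d s : ℕ} (P : Fin m → Fin d → ℝ) (z : ℝ) {β : ℝ} (hβ : β ≤ 1)
    (T : Finset (EuclideanSpace ℝ (Fin d))) (S : Fin s → EuclideanSpace ℝ (Fin d)) (j : Fin s) :
    β * (T.card : ℝ) ≤ ((coveredSet z β T S P).card : ℝ) := by
  by_cases h0 : β * (T.card : ℝ) ≤ 0
  · exact h0.trans (Nat.cast_nonneg _)
  push Not at h0
  have hne := exists_le_card_sketchBall P z hβ T S j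
  -- Only finitely many distances occur, so a radius slightly above the infimum captures no further
  -- point.
  have hev : ∀ᶠ r in nhdsWithin (coverRadius z β T S P) (Set.Ioi (coverRadius z β T S P)),
      ∀ x ∈ T, ∀ i, sketchQuery P S x i ^ z ≤ r → sketchQuery P S x i ^ z ≤
        coverRadius z β T S P := by
    refine (Filter.eventually_all_finset T).2 fun x _ => Filter.eventually_all.2 fun i => ?_
    by_cases h : sketchQuery P S x i ^ z ≤ coverRadius z β T S P
    · exact Filter.Eventually.of_forall fun _ _ => h
    · filter_upwards [nhdsWithin_le_nhds (eventually_lt_nhds (not_le.1 h))] with r hr h'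
      exact absurd h' (not_le.2 hr)
  obtain ⟨r, hr, hvr⟩ := (hev.and self_mem_nhdsWithin).exists
  obtain ⟨r', hr', hlt⟩ := exists_lt_of_csInf_lt
    (s := {r : ℝ | β * (T.card : ℝ) ≤ ((sketchBall P z T S r).card : ℝ)}) hne hvr
  refine le_trans (α := ℝ) hr' (Nat.cast_le.2 (Finset.card_le_card fun x hx => ?_))
  simp only [sketchBall, coveredSet, Finset.mem_filter] at hx ⊢
  obtain ⟨hT, i, hi⟩ := hx
  exact ⟨hT, i, hr x hT i (hi.trans hlt.le)⟩

/-! ### Cheapest balls containing a fraction of the candidates -/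

/-- Among all families of `k` balls that are centred in `T` and contain a `b`-fraction of `T` there
is one with smallest radius `r`; arbitrary centres need a radius of at least `r / 2`. -/
theorem exists_optimal_balls {d k : ℕ} {b : ℝ} (hb0 : 0 < b) (hb : b ≤ 1)
    {T : Finset (EuclideanSpace ℝ (Fin d))} (hT : T.Nonempty) (hk : 0 < k) :
    ∃ (c : Fin k → EuclideanSpace ℝ (Fin d)) (r : ℝ), 0 ≤ r ∧
      b * (T.card : ℝ) ≤ ((T.filter fun x => ∃ j, ‖x - c j‖ ≤ r).card : ℝ) ∧
      ∀ C ∈ centerFamily d k,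
        (1 - b) * (T.card : ℝ) ≤ ((T.filter fun x => ∀ y ∈ C, r / 2 ≤ ‖x - y‖).card : ℝ) := by
  have hTc : (0 : ℝ) < T.card := by exact_mod_cast hT.card_pos
  -- Restricting centres to `T` and radii to pairwise distances in `T` makes the search finite, so a
  -- minimum exists.
  set F := ((Fintype.piFinset fun _ : Fin k => T) ×ˢ (T ×ˢ T)).filter fun q =>
    b * (T.card : ℝ) ≤ ((T.filter fun x => ∃ j, ‖x - q.1 j‖ ≤ ‖q.2.1 - q.2.2‖).card : ℝ) with hF
  have hFne : F.Nonempty := by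
    obtain ⟨t, ht⟩ := hT
    obtain ⟨u, hu, hmax⟩ := T.exists_max_image (fun x => ‖x - t‖) ⟨t, ht⟩
    refine ⟨(fun _ => t, (u, t)), ?_⟩
    simp only [hF, Finset.mem_filter, Finset.mem_product, Fintype.mem_piFinset]
    refine ⟨⟨fun _ => ht, hu, ht⟩, ?_⟩
    rw [Finset.filter_true_of_mem fun x hx => ⟨⟨0, hk⟩, hmax x hx⟩]
    exact mul_le_of_le_one_left hTc.le hb
  obtain ⟨⟨c, p⟩, hq, hmin⟩ := F.exists_min_image (fun q => ‖q.2.1 - q.2.2‖) hFne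
  have hq' := hq
  simp only [hF, Finset.mem_filter, Finset.mem_product, Fintype.mem_piFinset] at hq'
  refine ⟨c, ‖p.1 - p.2‖, norm_nonneg _, hq'.2, ?_⟩
  rintro C ⟨cc, rfl⟩
  by_contra! hlt
  set r := ‖p.1 - p.2‖ with hr
  set N := T.filter fun x => ¬ ∀ y ∈ Set.range cc, r / 2 ≤ ‖x - y‖ with hN
  have hcard : (T.card : ℝ) =
      ((T.filter fun x => ∀ y ∈ Set.range cc, r / 2 ≤ ‖x - y‖).card : ℝ) + N.card := by
    exact_mod_cast (Finset.card_filter_add_card_filter_not _).symm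
  have hNb : b * (T.card : ℝ) < N.card := by linarith
  have hNne : N.Nonempty := by
    rw [← Finset.card_pos]
    have : (0 : ℝ) < N.card := lt_of_le_of_lt (by positivity) hNb
    exact_mod_cast this
  have hNmem : ∀ x ∈ N, ∃ j, ‖x - cc j‖ < r / 2 := by
    intro x hx
    have := (Finset.mem_filter.1 hx).2
    push Not at this
    obtain ⟨_, ⟨j, rfl⟩, hj⟩ := this
    exact ⟨j, hj⟩
  -- Each centre that serves a point of `N` moves to one of the points it serves, which at most
  -- doubles distances and keeps them below `r`; other centres go to an arbitrary point of `T`.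
  have hc' : ∀ j, ∃ t ∈ T, (∃ x ∈ N, ‖x - cc j‖ < r / 2) → ‖t - cc j‖ < r / 2 := by
    intro j
    by_cases h : ∃ x ∈ N, ‖x - cc j‖ < r / 2
    · obtain ⟨x, hx, hxj⟩ := h
      exact ⟨x, (Finset.mem_filter.1 hx).1, fun _ => hxj⟩
    · exact ⟨p.1, hq'.1.2.1, fun h' => absurd h' h⟩
  choose c' hc'T hc' using hc'
  have hnear : ∀ x ∈ N, ∃ j, ‖x - c' j‖ < r := by
    intro x hx
    obtain ⟨j, hj⟩ := hNmem x hx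
    refine ⟨j, ?_⟩
    have h1 := hc' j ⟨x, hx, hj⟩
    calc ‖x - c' j‖ = ‖(x - cc j) - (c' j - cc j)‖ := by congr 1; abel
      _ ≤ ‖x - cc j‖ + ‖c' j - cc j‖ := norm_sub_le _ _
      _ < r := by linarith
  have : Nonempty (Fin k) := ⟨⟨0, hk⟩⟩
  choose! f hf using hnear
  -- The largest new distance is a pairwise distance in `T` and smaller than `r`, contradicting
  -- minimality.
  obtain ⟨u, hu, hmax⟩ := N.exists_max_image (fun x => ‖x - c' (f x)‖) hNne
  have hmem : (c', (u, c' (f u))) ∈ F := by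
    simp only [hF, Finset.mem_filter, Finset.mem_product, Fintype.mem_piFinset]
    refine ⟨⟨hc'T, (Finset.mem_filter.1 hu).1, hc'T _⟩, hNb.le.trans ?_⟩
    refine Nat.cast_le.2 (Finset.card_le_card fun x hx => ?_)
    exact Finset.mem_filter.2 ⟨(Finset.mem_filter.1 hx).1, f x, hmax x hx⟩
  exact absurd (hmin _ hmem) (not_le.2 (hf u hu))

/-! ### Cost of the points covered in one round -/

/-- If the sketch does not expand too many of the distances of points close to `S` and its total
excess is small, then the covered points are cheap. -/
theorem clusterCost_coveredSet_le {m d s : ℕ} {z β r : ℝ} (hz : 1 ≤ z)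
    {T X : Finset (EuclideanSpace ℝ (Fin d))} {S : Fin s → EuclideanSpace ℝ (Fin d)}
    {P : Fin m → Fin d → ℝ} (hβ : 0 < β * (T.card : ℝ)) (hr : 0 ≤ r) (hXT : X ⊆ T)
    {y : EuclideanSpace ℝ (Fin d) → Fin s} (hy : ∀ x ∈ X, ‖x - S (y x)‖ ≤ r)
    (hup : β * (T.card : ℝ) ≤
      ((X.filter fun x => ‖sketch P (x - S (y x))‖ ≤ 2 * ‖x - S (y x)‖).card : ℝ))
    (hlow : ∑ x ∈ T, ∑ j, shrinkExcess z (x - S j) P ≤ T.card) :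
    clusterCost z (coveredSet z β T S P) (Set.range S) ≤
      (16 ^ z + 1) * (T.card : ℝ) * (2 * r) ^ z := by
  have hz0 : 0 ≤ z := by linarith
  have hv : coverRadius z β T S P ≤ (2 * r) ^ z := by
    refine coverRadius_le hβ (hup.trans (Nat.cast_le.2 (Finset.card_le_card fun x hx => ?_)))
    obtain ⟨hxX, hx⟩ := Finset.mem_filter.1 hx
    refine Finset.mem_filter.2 ⟨hXT hxX, y x, ?_⟩
    rw [sketchQuery_eq]
    exact Real.rpow_le_rpow (norm_nonneg _) (hx.trans (by linarith [hy x hxX])) hz0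
  have hv0 : 0 ≤ (2 * r) ^ z := by positivity
  have hfin : ∀ x ∈ T, ∀ j, shrinkExcess z (x - S j) P ≠ ∞ := by
    intro x hx j
    refine ne_top_of_le_ne_top (ENNReal.natCast_ne_top T.card) (le_trans ?_ hlow)
    exact (Finset.single_le_sum (f := fun j => shrinkExcess z (x - S j) P)
      (fun _ _ => zero_le) (Finset.mem_univ j)).trans
      (Finset.single_le_sum (f := fun x => ∑ j, shrinkExcess z (x - S j) P)
        (fun _ _ => zero_le) hx)
  -- The sample that captures `x` depends on the sketch; summing the excess over all `j` avoids
  -- having to know which one it is.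
  have hpt : ∀ x ∈ coveredSet z β T S P, powDist z x (Set.range S) ≤
      (16 ^ z + ∑ j, (shrinkExcess z (x - S j) P).toReal) * (2 * r) ^ z := by
    intro x hx
    obtain ⟨hxT, j, hj⟩ := Finset.mem_filter.1 hx
    rw [sketchQuery_eq] at hj
    calc powDist z x (Set.range S) ≤ ‖x - S j‖ ^ z := powDist_le z x ⟨j, rfl⟩
      _ ≤ (16 ^ z + (shrinkExcess z (x - S j) P).toReal) * ‖sketch P (x - S j)‖ ^ z :=
        norm_rpow_le_of_shrinkExcess_ne_top hz (hfin x hxT j)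
      _ ≤ _ := by
        refine mul_le_mul (add_le_add_right ?_ _) (hj.trans hv) (by positivity)
          (add_nonneg (by positivity) (Finset.sum_nonneg fun _ _ => ENNReal.toReal_nonneg))
        exact Finset.single_le_sum (f := fun j => (shrinkExcess z (x - S j) P).toReal)
          (fun _ _ => ENNReal.toReal_nonneg) (Finset.mem_univ j)
  have hsum : ∑ x ∈ T, ∑ j, (shrinkExcess z (x - S j) P).toReal ≤ T.card := by
    have h1 := ENNReal.toReal_mono (ENNReal.natCast_ne_top T.card) hlow
    rw [ENNReal.toReal_sum fun x hx => ENNReal.sum_ne_top.2 fun j _ => hfin x hx j,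
      ENNReal.toReal_natCast] at h1
    refine le_trans (le_of_eq (Finset.sum_congr rfl fun x hx => ?_)) h1
    rw [ENNReal.toReal_sum fun j _ => hfin x hx j]
  calc clusterCost z (coveredSet z β T S P) (Set.range S)
      ≤ ∑ x ∈ coveredSet z β T S P,
        (16 ^ z + ∑ j, (shrinkExcess z (x - S j) P).toReal) * (2 * r) ^ z :=
        Finset.sum_le_sum hpt
    _ ≤ ∑ x ∈ T, (16 ^ z + ∑ j, (shrinkExcess z (x - S j) P).toReal) * (2 * r) ^ z :=
        Finset.sum_le_sum_of_subset_of_nonneg (coveredSet_subset z β T S P) fun x _ _ =>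
          mul_nonneg (add_nonneg (by positivity)
            (Finset.sum_nonneg fun _ _ => ENNReal.toReal_nonneg)) hv0
    _ = (T.card * 16 ^ z + ∑ x ∈ T, ∑ j, (shrinkExcess z (x - S j) P).toReal) * (2 * r) ^ z := by
        rw [← Finset.sum_mul, Finset.sum_add_distrib, Finset.sum_const, nsmul_eq_mul]
    _ ≤ (T.card * 16 ^ z + T.card) * (2 * r) ^ z := by gcongr
    _ = _ := by ring

/-- Markov's inequality is applied to two averages: the number of points of `X` whose chosen
distance is more than doubled, of which `g |T|` can be spared, and the total excess, compared with
`|T|`. Both means scale with `|T|`, so the failure probability does not depend on `|T|`. -/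
theorem gaussianSketch_clusterCost_coveredSet {m d s : ℕ} {z β g r : ℝ} (hz : 1 ≤ z)
    (hg : 0 < g) (hm : 3 * z ≤ m) {T X : Finset (EuclideanSpace ℝ (Fin d))}
    {S : Fin s → EuclideanSpace ℝ (Fin d)} (hβ : 0 < β * (T.card : ℝ)) (hr : 0 ≤ r) (hXT : X ⊆ T)
    {y : EuclideanSpace ℝ (Fin d) → Fin s} (hy : ∀ x ∈ X, ‖x - S (y x)‖ ≤ r)
    (hX : (β + g) * (T.card : ℝ) ≤ X.card) :
    gaussianSketch m d {P | ¬ clusterCost z (coveredSet z β T S P) (Set.range S) ≤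
      (16 ^ z + 1) * (T.card : ℝ) * (2 * r) ^ z} ≤
      ENNReal.ofReal (Real.exp (-(m / 2 : ℝ)) / g + s * (2 * (1 / 2) ^ m)) := by
  have hTc : (0 : ℝ) < T.card := by
    rcases (Nat.cast_nonneg (α := ℝ) T.card).eq_or_lt with h | h
    · rw [← h, mul_zero] at hβ; exact absurd hβ (lt_irrefl _)
    · exact h
  have hT0 : (T.card : ℝ≥0∞) ≠ 0 := by
    have : (T.card : ℝ) ≠ 0 := hTc.ne'
    exact_mod_cast this
  have hm0 : 0 < m := by
    have : (0 : ℝ) < m := by linarith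
    exact_mod_cast this
  set bad : EuclideanSpace ℝ (Fin d) → Set (Fin m → Fin d → ℝ) := fun x =>
    {P | 2 * ‖x - S (y x)‖ < ‖sketch P (x - S (y x))‖} with hbad
  have hbadm : ∀ x, MeasurableSet (bad x) := fun x =>
    measurableSet_lt measurable_const (measurable_norm_sketch _)
  set A := {P : Fin m → Fin d → ℝ | ENNReal.ofReal (g * T.card) ≤
    ∑ x ∈ X, (bad x).indicator (fun _ => (1 : ℝ≥0∞)) P} with hA
  set B := {P : Fin m → Fin d → ℝ | (T.card : ℝ≥0∞) ≤
    ∑ x ∈ T, ∑ j, shrinkExcess z (x - S j) P} with hB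
  have hsub : {P : Fin m → Fin d → ℝ | ¬ clusterCost z (coveredSet z β T S P) (Set.range S) ≤
      (16 ^ z + 1) * (T.card : ℝ) * (2 * r) ^ z} ⊆ A ∪ B := by
    intro P hP
    by_contra hAB
    simp only [Set.mem_union, not_or, hA, hB, Set.mem_ofPred_eq, not_le] at hAB
    refine hP (clusterCost_coveredSet_le hz hβ hr hXT hy ?_ hAB.2.le)
    have h1 := hAB.1
    have h2 : ∑ x ∈ X, (bad x).indicator (fun _ => (1 : ℝ≥0∞)) P =
        ((X.filter fun x => ¬ ‖sketch P (x - S (y x))‖ ≤ 2 * ‖x - S (y x)‖).card : ℝ≥0∞) := by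
      rw [Finset.card_filter]
      push_cast
      refine Finset.sum_congr rfl fun x _ => ?_
      simp [Set.indicator_apply, hbad]
    rw [h2, ← ENNReal.ofReal_natCast, ENNReal.ofReal_lt_ofReal_iff (by positivity)] at h1
    have h3 : (X.card : ℝ) =
        ((X.filter fun x => ‖sketch P (x - S (y x))‖ ≤ 2 * ‖x - S (y x)‖).card : ℝ) +
        (X.filter fun x => ¬ ‖sketch P (x - S (y x))‖ ≤ 2 * ‖x - S (y x)‖).card := by
      exact_mod_cast (Finset.card_filter_add_card_filter_not _).symm
    linarith
  have hAle : gaussianSketch m d A ≤ ENNReal.ofReal (Real.exp (-(m / 2 : ℝ)) / g) := by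
    refine (meas_ge_le_lintegral_div (Finset.measurable_fun_sum _ fun x _ =>
      measurable_const.indicator (hbadm x)).aemeasurable
      (by simpa using mul_pos hg hTc) ENNReal.ofReal_ne_top).trans ?_
    rw [lintegral_finsetSum _ fun x _ => measurable_const.indicator (hbadm x)]
    have h1 : ∑ x ∈ X, ∫⁻ P, (bad x).indicator (fun _ => (1 : ℝ≥0∞)) P ∂gaussianSketch m d ≤
        ENNReal.ofReal (T.card * Real.exp (-(m / 2 : ℝ))) := by
      calc _ ≤ ∑ x ∈ X, ENNReal.ofReal (Real.exp (-(m / 2 : ℝ))) := by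
            refine Finset.sum_le_sum fun x _ => ?_
            rw [lintegral_indicator_const (hbadm x), one_mul]
            exact gaussianSketch_two_mul_lt_norm_sketch_le hm0 _
        _ = X.card * ENNReal.ofReal (Real.exp (-(m / 2 : ℝ))) := by
            rw [Finset.sum_const, nsmul_eq_mul]
        _ ≤ T.card * ENNReal.ofReal (Real.exp (-(m / 2 : ℝ))) := by
            gcongr
        _ = _ := by rw [ENNReal.ofReal_mul (by positivity), ENNReal.ofReal_natCast]
    refine (ENNReal.div_le_div_right h1 _).trans ?_
    rw [← ENNReal.ofReal_div_of_pos (by positivity)]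
    apply ENNReal.ofReal_le_ofReal
    rw [mul_comm g, mul_div_mul_left _ _ hTc.ne']
  have hBle : gaussianSketch m d B ≤ ENNReal.ofReal (s * (2 * (1 / 2) ^ m)) := by
    have hmeas : ∀ x, Measurable fun P : Fin m → Fin d → ℝ =>
        ∑ j, shrinkExcess z (x - S j) P := fun x =>
      Finset.measurable_fun_sum _ fun j _ => measurable_shrinkExcess z _
    refine (meas_ge_le_lintegral_div (Finset.measurable_fun_sum _ fun x _ =>
      hmeas x).aemeasurable hT0 (ENNReal.natCast_ne_top _)).trans ?_
    rw [lintegral_finsetSum _ fun x _ => hmeas x]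
    refine ENNReal.div_le_of_le_mul ?_
    calc _ ≤ ∑ x ∈ T, ENNReal.ofReal (s * (2 * (1 / 2) ^ m)) := by
          refine Finset.sum_le_sum fun x _ => ?_
          rw [lintegral_finsetSum _ fun j _ => measurable_shrinkExcess z _]
          refine (Finset.sum_le_sum fun j _ => lintegral_shrinkExcess_le hz hm _).trans ?_
          rw [Finset.sum_const, Finset.card_univ, Fintype.card_fin, nsmul_eq_mul,
            ENNReal.ofReal_mul (Nat.cast_nonneg _), ENNReal.ofReal_natCast]
      _ = _ := by rw [Finset.sum_const, nsmul_eq_mul, mul_comm]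
  rw [ENNReal.ofReal_add (by positivity) (by positivity)]
  exact (measure_mono hsub).trans ((measure_union_le _ _).trans (add_le_add hAle hBle))

/-! ### Failure probabilities of sampling and sketching -/

theorem PMF.toOuterMeasure_le_one {α : Type*} (p : PMF α) (s : Set α) :
    p.toOuterMeasure s ≤ 1 := by
  rw [PMF.toOuterMeasure_apply, ← p.tsum_coe]
  exact ENNReal.tsum_le_tsum fun a => Set.indicator_le_self _ _ a

/-- Union bound for a two-stage experiment: either the first stage fails, or the second does after a
successful first stage. -/
theorem PMF.toOuterMeasure_bind_le {α γ : Type*} (p : PMF α) (f : α → PMF γ) (E : Set γ)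
    (B : Set α) {q : ℝ≥0∞}
    (h : ∀ a ∈ p.support, a ∉ B → (f a).toOuterMeasure E ≤ q) :
    (p.bind f).toOuterMeasure E ≤ p.toOuterMeasure B + q := by
  rw [PMF.toOuterMeasure_bind_apply, PMF.toOuterMeasure_apply]
  calc ∑' a, p a * (f a).toOuterMeasure E ≤ ∑' a, (B.indicator p a + p a * q) := by
        refine ENNReal.tsum_le_tsum fun a => ?_
        by_cases ha : a ∈ B
        · rw [Set.indicator_of_mem ha]
          calc p a * (f a).toOuterMeasure E ≤ p a * 1 := by
                gcongr; exact PMF.toOuterMeasure_le_one _ _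
            _ = p a := mul_one _
            _ ≤ _ := le_self_add
        · rw [Set.indicator_of_notMem ha, zero_add]
          by_cases hp : p a = 0
          · simp [hp]
          · gcongr
            exact h a ((PMF.mem_support_iff _ _).2 hp) ha
    _ = _ := by rw [ENNReal.tsum_add, ENNReal.tsum_mul_right, PMF.tsum_coe, one_mul]

/-- The covered set takes finitely many values, each on a measurable event, so events of the
discrete law can be estimated under the Gaussian measure. -/
theorem coveredLaw_toOuterMeasure_le {d s : ℕ} (m : ℕ) (z β : ℝ)
    (T : Finset (EuclideanSpace ℝ (Fin d))) (S : Fin s → EuclideanSpace ℝ (Fin d))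
    (E : Set (Finset (EuclideanSpace ℝ (Fin d)))) :
    (coveredLaw m z β T S).toOuterMeasure E ≤
      gaussianSketch m d {P | coveredSet z β T S P ∈ E} := by
  have h1 := sum_measure_preimage_singleton (μ := gaussianSketch m d)
    (T.powerset.filter (· ∈ E)) (f := coveredSet (m := m) z β T S)
    (fun T' _ => measurableSet_coveredSet_eq z β T S T')
  rw [PMF.toOuterMeasure_apply, tsum_eq_sum (s := T.powerset.filter (· ∈ E))]
  · refine le_trans (Finset.sum_le_sum fun D hD => Set.indicator_le_self _ _ D) ?_
    refine (le_of_eq h1).trans (measure_mono fun P hP => ?_)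
    exact (Finset.mem_filter.1 (Finset.mem_coe.1 hP)).2
  · intro D hD
    by_cases hDE : D ∈ E
    · rw [Set.indicator_of_mem hDE]
      have : {P : Fin m → Fin d → ℝ | coveredSet z β T S P = D} = ∅ := by
        refine Set.eq_empty_of_forall_notMem fun P hP => hD ?_
        have hP' : coveredSet z β T S P = D := hP
        exact Finset.mem_filter.2
          ⟨Finset.mem_powerset.2 (hP' ▸ coveredSet_subset z β T S P), hDE⟩
      change gaussianSketch m d {P | coveredSet z β T S P = D} = 0
      rw [this, measure_empty]
    · exact Set.indicator_of_notMem hDE _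

/-- `s` uniform samples from `T` miss a given `g`-fraction of `T` with probability at most
`(1 - g) ^ s`. -/
theorem sampleLaw_forall_notMem_le {d : ℕ} (s : ℕ) {g : ℝ}
    {T Y : Finset (EuclideanSpace ℝ (Fin d))} (hT : T.Nonempty) (hY : Y ⊆ T)
    (hg : g * (T.card : ℝ) ≤ Y.card) :
    (sampleLaw s T hT).toOuterMeasure {S | ∀ i, S i ∉ Y} ≤
      ENNReal.ofReal (Real.exp (-(g * s))) := by
  have := hT.to_subtype
  have hTc : (0 : ℝ) < T.card := by exact_mod_cast hT.card_pos
  rw [sampleLaw, PMF.toOuterMeasure_map_apply, PMF.toOuterMeasure_uniformOfFintype_apply]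
  have h1 : Fintype.card ((fun (f : Fin s → T) j => (f j : EuclideanSpace ℝ (Fin d))) ⁻¹'
      {S | ∀ i, S i ∉ Y}) = (T.card - Y.card) ^ s := by
    rw [← Finset.card_sdiff_of_subset hY, ← Fintype.card_coe (T \ Y)]
    conv_rhs => rw [← Fintype.card_fin s]
    rw [← Fintype.card_fun]
    refine Fintype.card_congr ⟨fun f i => ⟨f.1 i, Finset.mem_sdiff.2 ⟨(f.1 i).2, f.2 i⟩⟩,
      fun f => ⟨fun i => ⟨f i, (Finset.mem_sdiff.1 (f i).2).1⟩,
        fun i => (Finset.mem_sdiff.1 (f i).2).2⟩, fun f => rfl, fun f => rfl⟩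
  rw [h1, Fintype.card_fun, Fintype.card_fin, Fintype.card_coe, ← ENNReal.ofReal_natCast,
    ← ENNReal.ofReal_natCast, ← ENNReal.ofReal_div_of_pos (by positivity)]
  apply ENNReal.ofReal_le_ofReal
  rw [Nat.cast_pow, Nat.cast_pow, ← div_pow, Nat.cast_sub (Finset.card_le_card hY),
    show -(g * s) = s * (-g) by ring, Real.exp_nat_mul]
  have h2 : (Y.card : ℝ) ≤ T.card := Nat.cast_le.2 (Finset.card_le_card hY)
  refine pow_le_pow_left₀ (div_nonneg (by linarith) hTc.le) ?_ s
  rw [div_le_iff₀ hTc]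
  nlinarith [Real.add_one_le_exp (-g)]

/-- The samples hit most of the clusters of a partition into `k` clusters, by weight. -/
theorem sampleLaw_hit {d k : ℕ} (s : ℕ) {b g : ℝ} {T X : Finset (EuclideanSpace ℝ (Fin d))}
    (hT : T.Nonempty) (hXT : X ⊆ T) (hX : b * (T.card : ℝ) ≤ X.card)
    (f : EuclideanSpace ℝ (Fin d) → Fin k) :
    (sampleLaw s T hT).toOuterMeasure
      {S | ¬ (b - g) * (T.card : ℝ) ≤ ((X.filter fun x => ∃ i, S i ∈ X ∧ f (S i) = f x).card : ℝ)}
      ≤ ENNReal.ofReal (Real.exp (k - g * s)) := by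
  -- Union bound over the at most `2^k` sets of clusters of total weight at least `g |T|`; on the
  -- bad event the set of missed clusters is one of them.
  set 𝒥 := (Finset.univ : Finset (Finset (Fin k))).filter fun J =>
    g * (T.card : ℝ) ≤ ((X.filter fun x => f x ∈ J).card : ℝ) with h𝒥
  have hsub : {S : Fin s → EuclideanSpace ℝ (Fin d) | ¬ (b - g) * (T.card : ℝ) ≤
      ((X.filter fun x => ∃ i, S i ∈ X ∧ f (S i) = f x).card : ℝ)} ⊆
      ⋃ J ∈ 𝒥, {S | ∀ i, S i ∉ X.filter fun x => f x ∈ J} := by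
    intro S hS
    have hS' : ¬ (b - g) * (T.card : ℝ) ≤
      ((X.filter fun x => ∃ i, S i ∈ X ∧ f (S i) = f x).card : ℝ) := hS
    have h1 : (X.card : ℝ) = ((X.filter fun x => ∃ i, S i ∈ X ∧ f (S i) = f x).card : ℝ) +
        (X.filter fun x => ¬ ∃ i, S i ∈ X ∧ f (S i) = f x).card := by
      exact_mod_cast (Finset.card_filter_add_card_filter_not _).symm
    set J := Finset.univ.filter fun j : Fin k => ¬ ∃ i, S i ∈ X ∧ f (S i) = j with hJ
    have h2 : (X.filter fun x => ¬ ∃ i, S i ∈ X ∧ f (S i) = f x) = X.filter fun x => f x ∈ J :=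
      Finset.filter_congr fun x _ => by simp [hJ]
    rw [h2] at h1
    refine Set.mem_biUnion (x := J) ?_ ?_
    · rw [Finset.mem_coe, h𝒥, Finset.mem_filter]
      exact ⟨Finset.mem_univ _, by linarith⟩
    · intro i hi
      obtain ⟨hiX, hiJ⟩ := Finset.mem_filter.1 hi
      exact (Finset.mem_filter.1 hiJ).2 ⟨i, hiX, rfl⟩
  refine (measure_mono hsub).trans ((measure_biUnion_finset_le _ _).trans ?_)
  calc ∑ J ∈ 𝒥, (sampleLaw s T hT).toOuterMeasure {S | ∀ i, S i ∉ X.filter fun x => f x ∈ J}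
      ≤ ∑ J ∈ 𝒥, ENNReal.ofReal (Real.exp (-(g * s))) :=
        Finset.sum_le_sum fun J hJ => sampleLaw_forall_notMem_le s hT
          ((Finset.filter_subset _ _).trans hXT) (Finset.mem_filter.1 hJ).2
    _ = ENNReal.ofReal (𝒥.card * Real.exp (-(g * s))) := by
        rw [Finset.sum_const, nsmul_eq_mul, ENNReal.ofReal_mul (by positivity),
          ENNReal.ofReal_natCast]
    _ ≤ _ := by
        apply ENNReal.ofReal_le_ofReal
        have h1 : (𝒥.card : ℝ) ≤ 2 ^ k := by
          have : 𝒥.card ≤ 2 ^ k := by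
            simpa using Finset.card_le_univ 𝒥
          exact_mod_cast this
        have h2 : (2 : ℝ) ^ k ≤ Real.exp k := by
          rw [show (k : ℝ) = k * 1 by ring, Real.exp_nat_mul]
          gcongr
          linarith [Real.add_one_le_exp (1 : ℝ)]
        rw [sub_eq_add_neg, Real.exp_add]
        gcongr
        exact h1.trans h2

/-! ### A single round is cheap -/

/-- Serving the discarded points `D` by the sample `S` costs at most a constant times `|T| μ`, for
a threshold `μ` such that every set of `k` centres leaves a `g`-fraction of `T` with cost at
least `μ`. -/
def IsCheapRound {d s : ℕ} (z : ℝ) (k : ℕ) (g Λ : ℝ) (T : Finset (EuclideanSpace ℝ (Fin d)))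
    (S : Fin s → EuclideanSpace ℝ (Fin d)) (D : Finset (EuclideanSpace ℝ (Fin d))) : Prop :=
  ∃ μ, 0 ≤ μ ∧ clusterCost z D (Set.range S) ≤ Λ * (T.card : ℝ) * μ ∧
    ∀ C ∈ centerFamily d k, g * (T.card : ℝ) ≤ ((T.filter fun x => μ ≤ powDist z x C).card : ℝ)

/-- Optimal balls hold a `β + 2g` fraction of `T`; one `g` is given up to balls without a sample,
another to distances stretched by the sketch, and `β` remains to be covered. The `g` fraction
outside the balls is what the lower bound for arbitrary centres uses. -/
theorem round_isCheap {d m s k : ℕ} {z β g : ℝ} (hz : 1 ≤ z) (hβ : 0 < β) (hg : 0 < g)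
    (hβg : β + 3 * g = 1) (hm : 3 * z ≤ m) (hk : 0 < k)
    {T : Finset (EuclideanSpace ℝ (Fin d))} (hT : T.Nonempty) :
    (sampleLaw s T hT).toOuterMeasure {S | ¬ (coveredLaw m z β T S).toOuterMeasure
      {D | ¬ IsCheapRound z k g ((16 ^ z + 1) * 8 ^ z) T S D} ≤
        ENNReal.ofReal (Real.exp (-(m / 2 : ℝ)) / g + s * (2 * (1 / 2) ^ m))} ≤
      ENNReal.ofReal (Real.exp (k - g * s)) := by
  have hTc : (0 : ℝ) < T.card := by exact_mod_cast hT.card_pos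
  obtain ⟨c, r, hr, hcov, hopt⟩ := exists_optimal_balls (b := β + 2 * g) (by linarith)
    (by linarith) hT hk
  set X := T.filter fun x => ∃ j, ‖x - c j‖ ≤ r with hX
  have : Nonempty (Fin k) := ⟨⟨0, hk⟩⟩
  have hnear : ∀ x ∈ X, ∃ j, ‖x - c j‖ ≤ r := fun x hx => (Finset.mem_filter.1 hx).2
  choose! f hf using hnear
  refine (measure_mono fun S hS => ?_).trans
    (sampleLaw_hit s (b := β + 2 * g) (g := g) hT (Finset.filter_subset _ _) hcov f)
  intro hhit
  refine hS ((coveredLaw_toOuterMeasure_le m z β T S _).trans ?_)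
  set X' := X.filter fun x => ∃ i, S i ∈ X ∧ f (S i) = f x with hX'
  have hX'card : (β + g) * (T.card : ℝ) ≤ X'.card := by
    refine le_trans (le_of_eq ?_) hhit
    ring
  have hX'ne : X'.Nonempty := by
    rw [← Finset.card_pos]
    have : (0 : ℝ) < X'.card := lt_of_lt_of_le (by positivity) hX'card
    exact_mod_cast this
  have : Nonempty (Fin s) := by
    obtain ⟨x, hx⟩ := hX'ne
    obtain ⟨i, -⟩ := (Finset.mem_filter.1 hx).2
    exact ⟨i⟩
  have hex : ∀ x ∈ X', ∃ i, ‖x - S i‖ ≤ 2 * r := by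
    intro x hx
    obtain ⟨hxX, i, hiX, hi⟩ := Finset.mem_filter.1 hx
    refine ⟨i, ?_⟩
    calc ‖x - S i‖ = ‖(x - c (f x)) - (S i - c (f (S i)))‖ := by rw [hi]; congr 1; abel
      _ ≤ ‖x - c (f x)‖ + ‖S i - c (f (S i))‖ := norm_sub_le _ _
      _ ≤ 2 * r := by linarith [hf x hxX, hf _ hiX]
  choose! y hy using hex
  refine (measure_mono fun P hP => ?_).trans (gaussianSketch_clusterCost_coveredSet hz hg hm
    (by positivity) (by linarith : 0 ≤ 2 * r)
    ((Finset.filter_subset _ _).trans (Finset.filter_subset _ _)) hy hX'card)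
  intro hcost
  -- Covered at distance `2r` and doubled by the sketch, against the lower bound `r / 2`: the ratio
  -- `8` is the source of `8 ^ z`.
  refine hP ⟨(r / 2) ^ z, by positivity, hcost.trans (le_of_eq ?_), fun C hC => ?_⟩
  · rw [show 2 * (2 * r) = 8 * (r / 2) by ring, Real.mul_rpow (by norm_num) (by linarith)]
    ring
  · have h1 := hopt C hC
    rw [show 1 - (β + 2 * g) = g by linarith] at h1
    refine h1.trans (Nat.cast_le.2 (Finset.card_le_card fun x hx => ?_))
    obtain ⟨hxT, hx⟩ := Finset.mem_filter.1 hx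
    refine Finset.mem_filter.2 ⟨hxT, ?_⟩
    obtain ⟨cc, rfl⟩ := hC
    have : Nonempty (Set.range cc) := (Set.range_nonempty cc).to_subtype
    exact le_ciInf fun q => Real.rpow_le_rpow (by linarith) (hx q.1 q.2) (by linarith)

/-! ### Number of rounds and amortised cost -/

/-- A bound on the number of rounds when `n` candidates are left. -/
def roundBound (β : ℝ) (s n : ℕ) : ℝ :=
  if s < n then 1 + Real.log (n / s) / β else 0

theorem roundBound_nonneg {β : ℝ} (hβ : 0 < β) {s : ℕ} (hs : 0 < s) (n : ℕ) :
    0 ≤ roundBound β s n := by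
  have hs' : (0 : ℝ) < s := by exact_mod_cast hs
  unfold roundBound
  split_ifs with h
  · have h' : (s : ℝ) < n := by exact_mod_cast h
    have : 0 ≤ Real.log (n / s) := Real.log_nonneg ((one_le_div hs').2 h'.le)
    positivity
  · exact le_rfl

/-- The logarithm drops by at least `β` because `log (1 - β) ≤ -β`; the summand `1` pays for the
last round, after which at most `s` candidates remain. -/
theorem roundBound_step {β : ℝ} (hβ : 0 < β) {s n n' : ℕ} (hs : 0 < s) (hn : s < n)
    (hn' : (n' : ℝ) ≤ (1 - β) * n) : roundBound β s n' + 1 ≤ roundBound β s n := by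
  have hs' : (0 : ℝ) < s := by exact_mod_cast hs
  have hsn : (s : ℝ) < n := by exact_mod_cast hn
  have hn0 : (0 : ℝ) < n := hs'.trans hsn
  have hlog : 0 ≤ Real.log (n / s) := Real.log_nonneg ((one_le_div hs').2 hsn.le)
  unfold roundBound
  rw [if_pos hn]
  split_ifs with h
  · have hsn' : (s : ℝ) < n' := by exact_mod_cast h
    have hβ1 : 0 < 1 - β := by
      by_contra! h0
      nlinarith
    have h1 : Real.log (n' / s) ≤ Real.log (n / s) - β := by
      calc Real.log (n' / s) ≤ Real.log ((1 - β) * (n / s)) := by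
            apply Real.log_le_log (div_pos (hs'.trans hsn') hs')
            rw [← mul_div_assoc]
            gcongr
        _ = Real.log (1 - β) + Real.log (n / s) :=
            Real.log_mul hβ1.ne' (by positivity)
        _ ≤ _ := by linarith [Real.log_le_sub_one_of_pos hβ1]
    have h2 : Real.log (n' / s) / β ≤ (Real.log (n / s) - β) / β := by gcongr
    rw [sub_div, div_self hβ.ne'] at h2
    linarith
  · have : 0 ≤ Real.log (n / s) / β := by positivity
    linarith

/-- The property of an output `W` of the main loop, started with candidates `T` and centres `V`,
that is maintained by cheap rounds. -/
def IsGoodOutput {d : ℕ} (z β Λ K : ℝ) (k s : ℕ) (T V W : Finset (EuclideanSpace ℝ (Fin d))) :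
    Prop :=
  V ⊆ W ∧ (W.card : ℝ) ≤ V.card + s * (1 + roundBound β s T.card) ∧
    ∀ C ∈ centerFamily d k, ∀ M : ℝ, 0 ≤ M →
      clusterCost z T (W : Set (EuclideanSpace ℝ (Fin d))) ≤
        Λ * (M * T.card / β + K * ∑ x ∈ T, max (powDist z x C - M) 0)

theorem isGoodOutput_union {d : ℕ} {z β Λ K : ℝ} {k s : ℕ} (hz : 1 ≤ z) (hβ : 0 < β)
    (hΛ : 0 ≤ Λ) (hK : 0 ≤ K) {T : Finset (EuclideanSpace ℝ (Fin d))} (hT : T.card ≤ s)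
    (V : Finset (EuclideanSpace ℝ (Fin d))) : IsGoodOutput z β Λ K k s T V (V ∪ T) := by
  refine ⟨Finset.subset_union_left, ?_, fun C _ M hM => ?_⟩
  · have h1 : ((V ∪ T).card : ℝ) ≤ V.card + s := by
      exact_mod_cast (Finset.card_union_le V T).trans (by omega)
    rw [roundBound, if_neg (by omega)]
    linarith
  · rw [clusterCost_eq_zero_of_subset hz (by simp)]
    have : 0 ≤ ∑ x ∈ T, max (powDist z x C - M) 0 :=
      Finset.sum_nonneg fun _ _ => le_max_right _ _
    positivity

/-- Raising the truncation level from `M` to `μ` saves the full `μ - M` on every term that reaches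
`μ`. -/
theorem sum_max_sub_add_le {ι : Type*} (T : Finset ι) (a : ι → ℝ) {M μ : ℝ} (h : M ≤ μ) :
    ∑ x ∈ T, max (a x - μ) 0 + (μ - M) * (T.filter fun x => μ ≤ a x).card ≤
      ∑ x ∈ T, max (a x - M) 0 := by
  have h1 : (μ - M) * ((T.filter fun x => μ ≤ a x).card : ℝ) =
      ∑ x ∈ T, if μ ≤ a x then μ - M else 0 := by
    rw [← Finset.sum_filter, Finset.sum_const, nsmul_eq_mul, mul_comm]
  rw [h1, ← Finset.sum_add_distrib]
  refine Finset.sum_le_sum fun x _ => ?_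
  split_ifs with hx
  · rw [max_eq_left (by linarith), max_eq_left (by linarith)]
    linarith
  · rw [max_eq_right (by linarith : a x - μ ≤ 0), add_zero]
    exact le_max_right _ _

/-- For a threshold `M' ≥ μ`, removing a `β` fraction frees `M' |T|` in the flat term `M' |T| / β`,
enough for the round's `|T| μ`. If `M < μ`, this is used with `M' = μ`: the flat term grows by `(μ -
M) |T| / β`, the truncated sum falls by at least `(μ - M) g |T|`, and `K = 1 / (β g)` balances the
two. -/
theorem IsGoodOutput.step {d s k : ℕ} {z β g Λ : ℝ} (hβ : 0 < β) (hg : 0 < g) (hΛ : 0 ≤ Λ)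
    (hs : 0 < s) {T D V W : Finset (EuclideanSpace ℝ (Fin d))}
    {S : Fin s → EuclideanSpace ℝ (Fin d)} (hT : s < T.card) (hD : D ⊆ T)
    (hDc : β * (T.card : ℝ) ≤ D.card) (hround : IsCheapRound z k g Λ T S D)
    (h : IsGoodOutput z β Λ (1 / (β * g)) k s (T \ D) (V ∪ Finset.univ.image S) W) :
    IsGoodOutput z β Λ (1 / (β * g)) k s T V W := by
  obtain ⟨hVW, hcard, hcost⟩ := h
  have : Nonempty (Fin s) := ⟨⟨0, hs⟩⟩
  have hn' : ((T \ D).card : ℝ) ≤ (1 - β) * T.card := by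
    have : ((T \ D).card : ℝ) = T.card - D.card := by
      rw [Finset.card_sdiff_of_subset hD, Nat.cast_sub (Finset.card_le_card hD)]
    linarith
  refine ⟨Finset.subset_union_left.trans hVW, ?_, fun C hC M hM => ?_⟩
  · have h1 : ((V ∪ Finset.univ.image S).card : ℝ) ≤ V.card + s := by
      have h2 : (Finset.univ.image S).card ≤ s := by
        simpa using Finset.card_image_le (s := Finset.univ) (f := S)
      exact_mod_cast (Finset.card_union_le V _).trans (by omega)
    have h3 := roundBound_step hβ hs hT hn'
    have hs' : (0 : ℝ) < s := by exact_mod_cast hs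
    nlinarith
  obtain ⟨μ, hμ, hDcost, hlarge⟩ := hround
  have hSW : Set.range S ⊆ (W : Set (EuclideanSpace ℝ (Fin d))) := by
    rintro _ ⟨i, rfl⟩
    exact hVW (Finset.mem_union_right _ (Finset.mem_image_of_mem S (Finset.mem_univ i)))
  have hsplit : clusterCost z T (W : Set (EuclideanSpace ℝ (Fin d))) ≤
      clusterCost z (T \ D) (W : Set (EuclideanSpace ℝ (Fin d))) + Λ * T.card * μ := by
    have h1 := (clusterCost_anti z D (Set.range_nonempty S) hSW).trans hDcost
    have h2 : clusterCost z T (W : Set (EuclideanSpace ℝ (Fin d))) =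
        clusterCost z (T \ D) (W : Set (EuclideanSpace ℝ (Fin d))) +
          clusterCost z D (W : Set (EuclideanSpace ℝ (Fin d))) :=
      (Finset.sum_sdiff hD).symm
    linarith
  have hmono : ∀ M' : ℝ, ∑ x ∈ T \ D, max (powDist z x C - M') 0 ≤
      ∑ x ∈ T, max (powDist z x C - M') 0 := fun M' =>
    Finset.sum_le_sum_of_subset_of_nonneg Finset.sdiff_subset fun _ _ _ => le_max_right _ _
  have hbound : ∀ M' : ℝ, 0 ≤ M' → μ ≤ M' →
      clusterCost z T (W : Set (EuclideanSpace ℝ (Fin d))) ≤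
        Λ * (M' * T.card / β + 1 / (β * g) * ∑ x ∈ T, max (powDist z x C - M') 0) := by
    intro M' hM' hμM'
    have h1 : M' * ((T \ D).card : ℝ) / β ≤ M' * T.card / β - T.card * M' := by
      calc M' * ((T \ D).card : ℝ) / β ≤ M' * ((1 - β) * T.card) / β := by gcongr
        _ = _ := by field_simp
    have h2 : 1 / (β * g) * ∑ x ∈ T \ D, max (powDist z x C - M') 0 ≤
        1 / (β * g) * ∑ x ∈ T, max (powDist z x C - M') 0 := by
      exact mul_le_mul_of_nonneg_left (hmono M') (by positivity)
    have h3 : (T.card : ℝ) * μ ≤ T.card * M' := by gcongr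
    calc _ ≤ Λ * (M' * (T \ D).card / β +
          1 / (β * g) * ∑ x ∈ T \ D, max (powDist z x C - M') 0) + Λ * (T.card * μ) := by
          linarith [hcost C hC M' hM']
      _ = Λ * (M' * (T \ D).card / β +
          1 / (β * g) * ∑ x ∈ T \ D, max (powDist z x C - M') 0 + T.card * μ) := by ring
      _ ≤ _ := mul_le_mul_of_nonneg_left (by linarith) hΛ
  rcases le_total μ M with hμM | hμM
  · exact hbound M hM hμM
  · refine (hbound μ hμ le_rfl).trans (mul_le_mul_of_nonneg_left ?_ hΛ)
    have h1 := sum_max_sub_add_le T (fun x => powDist z x C) hμM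
    have h2 : (μ - M) * (g * T.card) ≤
        (μ - M) * ((T.filter fun x => μ ≤ powDist z x C).card : ℝ) :=
      mul_le_mul_of_nonneg_left (hlarge C hC) (by linarith)
    have h3 : 1 / (β * g) * (∑ x ∈ T, max (powDist z x C - μ) 0 + (μ - M) * (g * T.card)) ≤
        1 / (β * g) * ∑ x ∈ T, max (powDist z x C - M) 0 := by
      gcongr
      linarith
    have h4 : 1 / (β * g) * (∑ x ∈ T, max (powDist z x C - μ) 0 + (μ - M) * (g * T.card)) =
        1 / (β * g) * ∑ x ∈ T, max (powDist z x C - μ) 0 + (μ * T.card / β - M * T.card / β) := by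
      field_simp
    linarith

/-! ### Induction over the rounds -/

theorem mem_support_coveredLaw {d m s : ℕ} {z β : ℝ} {T : Finset (EuclideanSpace ℝ (Fin d))}
    {S : Fin s → EuclideanSpace ℝ (Fin d)} {D : Finset (EuclideanSpace ℝ (Fin d))}
    (h : D ∈ (coveredLaw m z β T S).support) :
    ∃ P : Fin m → Fin d → ℝ, coveredSet z β T S P = D := by
  by_contra hne
  push Not at hne
  refine (PMF.mem_support_iff _ _).1 h ?_
  change gaussianSketch m d {P | coveredSet z β T S P = D} = 0
  have : {P : Fin m → Fin d → ℝ | coveredSet z β T S P = D} = ∅ :=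
    Set.eq_empty_of_forall_notMem hne
  rw [this, measure_empty]

/-- The invariant is pulled back through each cheap round. One unit of `roundBound` is spent per
round on its failure probability, and since every round discards a point the fuel `N` never runs out
early. -/
theorem centerSetLoop_isGoodOutput {d m s k : ℕ} {z β g : ℝ} (hz : 1 ≤ z) (hβ : 0 < β)
    (hg : 0 < g) (hβg : β + 3 * g = 1) (hm : 3 * z ≤ m) (hk : 0 < k) (hs : 0 < s) (N : ℕ) :
    ∀ T V : Finset (EuclideanSpace ℝ (Fin d)), T.card ≤ N →
      (centerSetLoop m s z β N T V).toOuterMeasure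
        {W | ¬ IsGoodOutput z β ((16 ^ z + 1) * 8 ^ z) (1 / (β * g)) k s T V W} ≤
      ENNReal.ofReal (roundBound β s T.card * (Real.exp (k - g * s) +
        (Real.exp (-(m / 2 : ℝ)) / g + s * (2 * (1 / 2) ^ m)))) := by
  have hΛ : (0 : ℝ) ≤ (16 ^ z + 1) * 8 ^ z := by positivity
  have hK : 0 ≤ 1 / (β * g) := by positivity
  have hbase : ∀ T V : Finset (EuclideanSpace ℝ (Fin d)), T.card ≤ s →
      (PMF.pure (V ∪ T)).toOuterMeasure
        {W | ¬ IsGoodOutput z β ((16 ^ z + 1) * 8 ^ z) (1 / (β * g)) k s T V W} = 0 := by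
    intro T V hT
    rw [PMF.toOuterMeasure_pure_apply, if_neg]
    exact fun h => h (isGoodOutput_union hz hβ hΛ hK hT V)
  induction N with
  | zero =>
    intro T V hT
    rw [centerSetLoop, hbase T V (by omega)]
    exact zero_le
  | succ N ih =>
    intro T V hT
    rw [centerSetLoop]
    split_ifs with h
    swap
    · rw [hbase T V (by omega)]
      exact zero_le
    set p₁ := Real.exp (k - g * s) with hp₁
    set p₂ := Real.exp (-(m / 2 : ℝ)) / g + s * (2 * (1 / 2) ^ m) with hp₂
    have hp₁0 : 0 ≤ p₁ := by positivity
    have hp₂0 : 0 ≤ p₂ := by positivity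
    have hTc : (0 : ℝ) < T.card := by exact_mod_cast Nat.zero_lt_of_lt h
    have hTne : T.Nonempty := Finset.card_pos.1 (Nat.zero_lt_of_lt h)
    -- Comparison with a round that leaves no candidates.
    have hR1 : 1 ≤ roundBound β s T.card := by
      have := roundBound_step (n' := 0) hβ hs h (by
        rw [Nat.cast_zero]; exact mul_nonneg (by linarith) hTc.le)
      linarith [roundBound_nonneg hβ hs 0]
    have hrest : ∀ (S : Fin s → EuclideanSpace ℝ (Fin d)) D, D ∈ (coveredLaw m z β T S).support →
        D ∉ {D | ¬ IsCheapRound z k g ((16 ^ z + 1) * 8 ^ z) T S D} →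
        (centerSetLoop m s z β N (T \ D) (V ∪ Finset.univ.image S)).toOuterMeasure
          {W | ¬ IsGoodOutput z β ((16 ^ z + 1) * 8 ^ z) (1 / (β * g)) k s T V W} ≤
        ENNReal.ofReal ((roundBound β s T.card - 1) * (p₁ + p₂)) := by
      intro S D hD hcheap
      obtain ⟨P, rfl⟩ := mem_support_coveredLaw hD
      rw [Set.mem_ofPred_eq, not_not] at hcheap
      have hsub := coveredSet_subset z β T S P
      have hDc := le_card_coveredSet P z (by linarith : β ≤ 1) T S ⟨0, hs⟩
      have hcard := Finset.card_sdiff_of_subset hsub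
      have hle := Finset.card_le_card hsub
      have hpos : 0 < (coveredSet z β T S P).card := by
        have : (0 : ℝ) < (coveredSet z β T S P).card := lt_of_lt_of_le (by positivity) hDc
        exact_mod_cast this
      have hstep := roundBound_step (n' := (T \ coveredSet z β T S P).card) hβ hs h (by
        rw [hcard, Nat.cast_sub hle]; linarith)
      refine (measure_mono ?_).trans
        ((ih (T \ coveredSet z β T S P) (V ∪ Finset.univ.image S) (by omega)).trans
          (ENNReal.ofReal_le_ofReal ?_))
      · intro W hW hgood
        refine hW ?_
        exact IsGoodOutput.step hβ hg hΛ hs h hsub hDc hcheap hgood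
      · gcongr
        linarith
    calc _ ≤ ENNReal.ofReal p₁ + (ENNReal.ofReal p₂ +
          ENNReal.ofReal ((roundBound β s T.card - 1) * (p₁ + p₂))) := by
          refine (PMF.toOuterMeasure_bind_le _ _ _ _ fun S _ hS => ?_).trans
            (add_le_add_left (round_isCheap hz hβ hg hβg hm hk hTne) _)
          rw [Set.mem_ofPred_eq, not_not] at hS
          exact (PMF.toOuterMeasure_bind_le _ _ _ _ (hrest S)).trans (add_le_add_left hS _)
      _ = _ := by
          rw [← ENNReal.ofReal_add hp₂0 (mul_nonneg (by linarith) (by linarith)),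
            ← ENNReal.ofReal_add hp₁0 (add_nonneg hp₂0 (mul_nonneg (by linarith) (by linarith)))]
          congr 1
          ring

/-! ### Choice of constants and conclusion -/

theorem le_sketchDim {κ z δ ε₀ : ℝ} {s : ℕ} (hκ : 1 ≤ κ) (hz : 1 ≤ z) (hε : 0 < ε₀)
    (hε' : ε₀ < 1 / 10) (hδ : 0 < δ) (hδs : δ ≤ s) :
    100 * z * Real.log (s / δ) ≤ sketchDim κ s δ (ε₀ / z) := by
  have hlog : 0 ≤ Real.log (s / δ) := Real.log_nonneg ((one_le_div hδ).2 hδs)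
  refine le_trans ?_ (Nat.le_ceil _)
  -- The factor `100` is `(1 / ε₀)²` at worst, and `z² ≥ z`.
  have h1 : 100 * z ≤ ((ε₀ / z) ^ 2)⁻¹ := by
    rw [div_pow, inv_div, le_div_iff₀ (by positivity)]
    have : ε₀ ^ 2 ≤ 1 / 100 := by nlinarith
    nlinarith
  have h2 : 100 * z ≤ κ * ((ε₀ / z) ^ 2)⁻¹ := by
    have : 0 ≤ ((ε₀ / z) ^ 2)⁻¹ := by positivity
    nlinarith
  gcongr

/-- Both terms are controlled by `(δ / s)³`. One factor `δ / s` is kept for the sum over the rounds;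
the other two are at most `1 / s²` and absorb `1 / g + 2s ≤ s²`. -/
theorem sketch_failure_le {g δ : ℝ} {m s : ℕ} (hg : 0 < g) (hδ : 0 < δ) (hδ1 : δ < 1)
    (hs : 1 / g + 2 ≤ s) (hm : 6 * Real.log (s / δ) ≤ m) :
    Real.exp (-(m / 2 : ℝ)) / g + s * (2 * (1 / 2) ^ m) ≤ δ / s := by
  have hg' : 0 < 1 / g := by positivity
  have hs0 : (0 : ℝ) < s := by linarith
  have hq : 0 < δ / s := by positivity
  have h1 : Real.exp (-(m / 2 : ℝ)) ≤ (δ / s) ^ 3 := by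
    rw [← Real.exp_log (pow_pos hq 3), Real.exp_le_exp, Real.log_pow,
      ← inv_div (s : ℝ) δ, Real.log_inv]
    push_cast
    linarith
  have h2 : ((1 : ℝ) / 2) ^ m ≤ Real.exp (-(m / 2 : ℝ)) := by
    rw [show -(m / 2 : ℝ) = m * (-1 / 2) by ring, Real.exp_nat_mul]
    gcongr
    linarith [Real.add_one_le_exp (-1 / 2 : ℝ)]
  have h3 : (δ / s) ^ 2 ≤ 1 / s * (1 / s) := by
    rw [sq]
    gcongr
  calc Real.exp (-(m / 2 : ℝ)) / g + s * (2 * (1 / 2) ^ m)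
      ≤ (δ / s) ^ 3 / g + s * (2 * (δ / s) ^ 3) := by
        gcongr
        exact h2.trans h1
    _ = (δ / s) * ((δ / s) ^ 2 * (1 / g + 2 * s)) := by ring
    _ ≤ (δ / s) * (1 / s * (1 / s) * (1 / g + 2 * s)) := by gcongr
    _ ≤ (δ / s) * 1 := by
        gcongr
        rw [show 1 / (s : ℝ) * (1 / s) * (1 / g + 2 * s) = (1 / g + 2 * s) / (s * s) by
          field_simp, div_le_one (by positivity)]
        nlinarith
    _ = _ := mul_one _

theorem mainTheorem3 :
    ∃ κ₀ : ℝ, 0 < κ₀ ∧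
      ∀ z c₀ β ρ : ℝ, 1 ≤ z → 1 < c₀ → 0 < β → β < 1 → 0 < ρ →
        ∃ α₀ : ℝ, 1 ≤ α₀ ∧ ∀ α : ℝ, α₀ ≤ α →
          ∃ A : ℝ, 1 ≤ A ∧
            ∀ κ : ℝ, κ₀ ≤ κ →
              ∀ (d k : ℕ) (U : Finset (EuclideanSpace ℝ (Fin d))) (ε₀ δ : ℝ),
                1 ≤ k → ρ * Real.log (U.card : ℝ) ≤ (k : ℝ) →
                0 < ε₀ → ε₀ < 1 / 10 → 0 < δ → δ < 1 →
                  (centerSetGen α β κ z ε₀ δ k U).toOuterMeasure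
                      {V | ¬ ((V.card : ℝ) ≤ A * ((k : ℝ) *
                              max 1 (Real.log ((U.card : ℝ) / (k : ℝ)))) ∧
                            IsCenterSet z k A U (V : Set (EuclideanSpace ℝ (Fin d))))}
                    ≤ ENNReal.ofReal (Real.exp (-(c₀ * (k : ℝ))) + δ) := by
  refine ⟨1, one_pos, fun z c₀ β ρ hz hc₀ hβ hβ1 hρ => ?_⟩
  obtain ⟨g, hg, hβg⟩ : ∃ g : ℝ, 0 < g ∧ β + 3 * g = 1 :=
    ⟨(1 - β) / 3, by linarith, by ring⟩
  have hρβ : 0 < 1 / (ρ * β) := by positivity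
  have hgi : 0 < 1 / g := by positivity
  set a₁ := 2 * (1 / (ρ * β) + 1 + c₀) / g with ha₁
  have ha₁0 : 0 < a₁ := by positivity
  -- The summands ensure, in turn, that `s` exceeds the number of rounds, that `g s` beats the
  -- exponents in the sampling failure, and that `s ≥ 1 / g + 2`. The factors `2` make up for the
  -- floor in `s`.
  refine ⟨2 * (1 + 1 / (ρ * β)) + a₁ + 2 * (1 / g + 2), by linarith, fun α hα => ?_⟩
  set Λ : ℝ := (16 ^ z + 1) * 8 ^ z with hΛ
  have hΛ0 : 0 < Λ := by positivity
  have hα0 : 0 < α := by linarith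
  -- The first summand bounds the size of the output, the second its cost.
  refine ⟨α * (2 + 1 / β) + Λ * (1 / (β * g)), ?_, ?_⟩
  · have h1 : 0 < Λ * (1 / (β * g)) := by positivity
    have h2 : 0 < 1 / β := by positivity
    nlinarith
  intro κ hκ d k U ε₀ δ hk hkn hε hε' hδ hδ1
  have hk' : (1 : ℝ) ≤ k := by exact_mod_cast hk
  unfold centerSetGen
  set s := ⌊α * k⌋₊ with hs
  set m := sketchDim κ s δ (ε₀ / z) with hm
  have hsα : (s : ℝ) ≤ α * k := Nat.floor_le (by positivity)
  have hαk : α / 2 * k ≤ s := by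
    have h1 : α * k < s + 1 := Nat.lt_floor_add_one _
    nlinarith
  have hs1 : (1 + 1 / (ρ * β)) * k ≤ s :=
    le_trans (by gcongr; linarith) hαk
  have hs2 : (1 / (ρ * β) + 1 + c₀) * k ≤ g * s := by
    calc (1 / (ρ * β) + 1 + c₀) * k = g * (a₁ / 2 * k) := by rw [ha₁]; field_simp
      _ ≤ g * (α / 2 * k) := by gcongr; linarith
      _ ≤ g * s := by gcongr
  have hs3 : 1 / g + 2 ≤ s := by
    have h1 : (1 / g + 2) * 1 ≤ α / 2 * k := by gcongr; linarith
    linarith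
  have hks : (k : ℝ) ≤ s := by nlinarith
  have hs0' : (0 : ℝ) < s := by linarith
  have hs0 : 0 < s := by exact_mod_cast hs0'
  have hmlog := le_sketchDim (s := s) hκ hz hε hε' hδ (by linarith)
  have hlog : 1 / 2 ≤ Real.log (s / δ) := by
    calc (1 / 2 : ℝ) ≤ Real.log 2 := by linarith [Real.log_two_gt_d9]
      _ ≤ Real.log (s / δ) := by
        apply Real.log_le_log (by norm_num)
        rw [le_div_iff₀ hδ]
        nlinarith
  have hm3 : 3 * z ≤ m := by nlinarith
  have hm6 : 6 * Real.log (s / δ) ≤ m := by nlinarith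
  have hp₂ := sketch_failure_le hg hδ hδ1 hs3 hm6
  -- Here `k ≥ ρ log n` makes the number of rounds linear in `k`.
  have hR : roundBound β s U.card ≤ 1 + 1 / (ρ * β) * k := by
    unfold roundBound
    split_ifs with h
    · have hUc : (s : ℝ) < U.card := by exact_mod_cast h
      have h1 : Real.log (U.card / s) ≤ Real.log U.card := by
        apply Real.log_le_log (div_pos (by linarith) hs0')
        exact div_le_self (by linarith) (by linarith)
      have h2 : Real.log U.card ≤ k / ρ := by
        rw [le_div_iff₀ hρ]; linarith
      have h3 : Real.log (U.card / s) / β ≤ k / ρ / β := by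
        gcongr
        exact h1.trans h2
      have h4 : (k : ℝ) / ρ / β = 1 / (ρ * β) * k := by field_simp
      linarith
    · positivity
  have hR0 := roundBound_nonneg hβ hs0 U.card
  have hgood := centerSetLoop_isGoodOutput (d := d) (k := k) hz hβ hg hβg hm3 hk hs0 U.card U ∅
    le_rfl
  refine (measure_mono ?_).trans (hgood.trans (ENNReal.ofReal_le_ofReal ?_))
  · intro V hV hgoodV
    refine hV ?_
    obtain ⟨-, hcard, hcost⟩ := hgoodV
    set L := max 1 (Real.log ((U.card : ℝ) / (k : ℝ))) with hL
    have hL1 : 1 ≤ L := le_max_left _ _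
    constructor
    · have h1 : roundBound β s U.card ≤ 1 + 1 / β * L := by
        unfold roundBound
        split_ifs with h
        · have hUc : (s : ℝ) < U.card := by exact_mod_cast h
          have h2 : Real.log (U.card / s) ≤ L := by
            refine le_trans (Real.log_le_log (div_pos (by linarith) hs0') ?_) (le_max_right _ _)
            gcongr
          have h3 : Real.log (U.card / s) / β ≤ L / β := by gcongr
          have h4 : L / β = 1 / β * L := by ring
          linarith
        · positivity
      rw [Finset.card_empty, Nat.cast_zero, zero_add] at hcard
      have hβi : 0 < 1 / β := by positivity
      calc (V.card : ℝ) ≤ s * (1 + roundBound β s U.card) := hcard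
        _ ≤ (α * k) * ((2 + 1 / β) * L) := by
            gcongr
            linarith
        _ = α * (2 + 1 / β) * (k * L) := by ring
        _ ≤ _ := by
            gcongr
            have : 0 < Λ * (1 / (β * g)) := by positivity
            linarith
    · intro C hC
      -- At threshold `0` the flat term vanishes and the truncated sum is the full cost of `C`.
      have h1 := hcost C hC 0 le_rfl
      simp only [zero_mul, zero_div, zero_add, sub_zero,
        max_eq_left (powDist_nonneg z _ C)] at h1
      refine h1.trans ?_
      change Λ * (1 / (β * g) * clusterCost z U C) ≤ _
      rw [← mul_assoc]
      have h2 : 0 ≤ clusterCost z U C := Finset.sum_nonneg fun x _ => powDist_nonneg z x C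
      gcongr
      have : 0 < α * (2 + 1 / β) := by positivity
      linarith
  · rw [mul_add]
    apply add_le_add
    -- The number of rounds is at most `e^(k / (ρ β))`, which the choice of `a₁` absorbs.
    · calc roundBound β s U.card * Real.exp (k - g * s)
          ≤ Real.exp (1 / (ρ * β) * k) * Real.exp (k - g * s) := by
            gcongr
            exact hR.trans (by linarith [Real.add_one_le_exp (1 / (ρ * β) * k)])
        _ ≤ _ := by
            rw [← Real.exp_add, Real.exp_le_exp]
            linarith
    · have hRs : roundBound β s U.card ≤ s := hR.trans (by linarith)
      exact (mul_le_mul hRs hp₂ (by positivity) hs0'.le).trans_eq (mul_div_cancel₀ δ hs0'.ne')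

end
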